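/- Let $\Lambda$ be a finite set of sites, $b_i, b_i^\dagger$ the boson annihilation and creation operators, $\hat n_i=b_i^\dagger b_i$, and let $k\ge 3$ be an integer. Consider a Hermitian Hamiltonian $$H=H_0(\vec b,\vec b^\dagger)+V_+(\vec n)+\sum_{i\in\Lambda}U_i\,\hat n_i^{k/2},$$ where $H_0$ is a polynomial of degree at most $k$, written in normally ordered form (up to an additive constant) as $$H_0=\sum_{m=1}^{k}\ \sum_{i_1,\dots,i_m\in\Lambda}\ \sum_{s=1}^{m+1}J^{(s)}_{i_1,\dots,i_m}\,b^\dagger_{i_m}\cdots b^\dagger_{i_s}\,b_{i_{s-1}}\cdots b_{i_1},$$ and $V_+(\vec n)=\sum_{1\le m\le k/2}\sum_{i_1,\dots,i_m}V_{i_1,\dots,i_m}\hat n_{i_1}\cdots\hat n_{i_m}$ with coefficients $V_{i_1,\dots,i_m}\ge 0$. Put $$\bar J_{i,m}=\sum_{\substack{i_1,\dots,i_m\in\Lambda\\ i\in\{i_1,\dots,i_m\}}}\ \sum_{s=1}^{m+1}\bigl|J^{(s)}_{i_1,\dots,i_m}\bigr|,\qquad \bar{\mathcal J}=\max_{i\in\Lambda}\sum_{m=1}^{k}\bar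 J_{i,m}\bigl[1+(2m)^m\bigr],$$ and assume the repulsive condition $U_i>5\bar J_{i,k}$ for all $i\in\Lambda$. The quantum states are the unit vectors of the bosonic Fock space with finite moments $\langle\hat n_i^{k/2}\rangle$ ($i\in\Lambda$), or, if $H$ conserves the total boson number, those with a fixed total boson number $N$. Let $|\Omega\rangle$ be a ground state, i.e. a state that minimizes $\langle\psi|H|\psi\rangle$ over all these states, and let $E_0$ be its energy. For $\mathcal Q>0$ let $\mathcal E_{\mathcal Q}$ be the infimum of $\langle\Psi|H|\Psi\rangle$ over the states $|\Psi\rangle$ with $\max_{i\in\Lambda}\langle\Psi|\hat n_i^{k/2}|\Psi\rangle=\mathcal Q^{k/2}$ ($+\infty$ if there is none), and let $\check{\mathcal J}\in\mathbb R$ be such that $$\mathcal E_{\mathcal Q}-E_0\ \ge\ (U_j-\bar J_{j,k})\,\mathcal Q^{k/2}-\check{\mathcal J}\,\mathcal Q^{(k-1)/2}\qquad\text{for all }\mathcal Q>0,\ j\in\Lambda .$$ Let $i\in\Lambda$ be a site with $\bar J_{i,k}=0$ (this holds for every site if $H_0$ has degree at most $k-1$, as in the standard Bose–Hubbard model with $k=4$).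 Then for every real $x$, $$\langle\Omega|\Pi_{i,\ge x}|\Omega\rangle\ \le\ e^{-2(x-M_{i,0})/k},\qquad M_{i,0}=\max\left\{2^{2/k}\left(\frac{\check{\mathcal J}}{U_i}\right)^2,\ \left(\frac{16\bar{\mathcal J}+\check{\mathcal J}}{U_i}\right)^2\right\},$$ where $\Pi_{i,\ge x}$ is the projection onto the span of the Fock states with at least $x$ bosons on the site $i$. -/

import Mathlib

noncomputable section

namespace BoseHubbard

variable {Λ : Type*} [DecidableEq Λ]

/-- Occupation-number configurations: they label the Mott (Fock) basis `|N⃗⟩`. -/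
abbrev Config (Λ : Type*) : Type _ := Λ → ℕ

/-- The bosonic Fock space over the sites `Λ`, realized as the square-summable functions of the
occupation numbers; `ψ n` is the amplitude `⟨n|ψ⟩`. -/
abbrev FockSpace (Λ : Type*) : Type _ := lp (fun _ : Config Λ => ℂ) 2

/-- Formal operators. Polynomials in the boson operators have finitely many nonzero matrix elements
in each row of the Fock basis, so that they act on arbitrary amplitude functions. -/
abbrev Op (Λ : Type*) : Type _ := Module.End ℂ (Config Λ → ℂ)

/-- The annihilation operator: `(b_i ψ)(n) = √(n_i + 1) ψ(n + e_i)`. -/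
def annihilation (i : Λ) : Op Λ where
  toFun ψ n := (Real.sqrt ((n i : ℝ) + 1) : ℂ) * ψ (Function.update n i (n i + 1))
  map_add' ψ φ := by funext n; simp [mul_add]
  map_smul' c ψ := by funext n; simp [mul_left_comm]

/-- The creation operator: `(b_i† ψ)(n) = √(n_i) ψ(n - e_i)`, which is `0` if `n_i = 0`. -/
def creation (i : Λ) : Op Λ where
  toFun ψ n := (Real.sqrt (n i : ℝ) : ℂ) * ψ (Function.update n i (n i - 1))
  map_add' ψ φ := by funext n; simp [mul_add]
  map_smul' c ψ := by funext n; simp [mul_left_comm]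

/-- The operator `f(n̂)` that multiplies the basis vector `|n⟩` by `f n`. -/
def diag (f : Config Λ → ℝ) : Op Λ where
  toFun ψ n := (f n : ℂ) * ψ n
  map_add' ψ φ := by funext n; simp [mul_add]
  map_smul' c ψ := by funext n; simp [mul_left_comm]

/-- `b_i† b_i` is the multiplication by the occupation number of the site `i`. -/
theorem creation_mul_annihilation (i : Λ) :
    creation i * annihilation i = diag (fun n : Config Λ => (n i : ℝ)) := by
  refine LinearMap.ext fun ψ => ?_
  funext n
  rcases Nat.eq_zero_or_pos (n i) with h | h
  · simp [creation, annihilation, diag, h]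
  · have h1 : n i - 1 + 1 = n i := Nat.sub_add_cancel h
    have h2 : ((n i - 1 : ℕ) : ℝ) + 1 = (n i : ℝ) := by exact_mod_cast h1
    have h3 : (Real.sqrt (n i : ℝ) : ℂ) * (Real.sqrt (n i : ℝ) : ℂ) = ((n i : ℝ) : ℂ) := by
      rw [← Complex.ofReal_mul, Real.mul_self_sqrt (Nat.cast_nonneg _)]
    simp only [creation, annihilation, diag, Module.End.mul_apply, LinearMap.coe_mk,
      AddHom.coe_mk, Function.update_self, Function.update_idem, h1, h2, Function.update_eq_self]
    rw [← mul_assoc, h3]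

variable [Fintype Λ]

/-- The normally ordered monomial `b†_{i_m} ⋯ b†_{i_{a+1}} b_{i_a} ⋯ b_{i_1}` of degree `m` with
`a` annihilation operators; `idx j` is the site `i_{j+1}`. -/
def monomial {m : ℕ} (a : Fin (m + 1)) (idx : Fin m → Λ) : Op Λ :=
  (List.ofFn fun j : Fin m =>
    if (j : ℕ) < (a : ℕ) then annihilation (idx j) else creation (idx j)).reverse.prod

/-- The expectation value `⟨ψ|A|ψ⟩`, computed in the Fock basis. -/
def expect (A : Op Λ) (ψ : Config Λ → ℂ) : ℂ :=
  ∑' n, (starRingEnd ℂ) (ψ n) * A ψ n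

/-- The moment `⟨ψ| n̂_i^{k/2} |ψ⟩`. -/
def moment (k : ℕ) (i : Λ) (ψ : Config Λ → ℂ) : ℝ :=
  (expect (diag fun n => (n i : ℝ) ^ ((k : ℝ) / 2)) ψ).re

/-- The projection `Π_{i,≥x}` onto the configurations with at least `x` bosons on the site `i`. -/
def tailProj (i : Λ) (x : ℝ) : Op Λ :=
  diag (Set.indicator {n : Config Λ | x ≤ (n i : ℝ)} 1)

/-- The coefficients of a Hamiltonian `H₀(b, b†) + V₊(n) + ∑ᵢ Uᵢ n̂ᵢ^{k/2}`.
`J m a idx` is the coefficient in `H₀` of the normally ordered monomial `monomial a idx` of degree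
`m`, and `V m idx` is the coefficient in `V₊` of `n̂_{i_1} ⋯ n̂_{i_m}`. -/
structure Coeffs (Λ : Type*) where
  J : (m : ℕ) → Fin (m + 1) → (Fin m → Λ) → ℂ
  V : (m : ℕ) → (Fin m → Λ) → ℝ
  U : Λ → ℝ

/-- `H₀(b, b†)`: a general polynomial of degree at most `k` in the boson operators. -/
def hopping (k : ℕ) (c : Coeffs Λ) : Op Λ :=
  ∑ m ∈ Finset.range (k + 1), ∑ idx : Fin m → Λ, ∑ a : Fin (m + 1), c.J m a idx • monomial a idx

/-- The Hamiltonian `H = H₀(b, b†) + V₊(n) + ∑ᵢ Uᵢ n̂ᵢ^{k/2}`. -/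
def hamiltonian (k : ℕ) (c : Coeffs Λ) : Op Λ :=
  hopping k c
    + diag (fun n => ∑ m ∈ Finset.Icc 1 (k / 2), ∑ idx : Fin m → Λ,
        c.V m idx * ∏ j, (n (idx j) : ℝ))
    + diag (fun n => ∑ i, c.U i * (n i : ℝ) ^ ((k : ℝ) / 2))

/-- `⟨n'|A|n⟩ = conj ⟨n|A|n'⟩` for all Fock basis vectors. -/
def IsHermitian (A : Op Λ) : Prop :=
  ∀ n n' : Config Λ, A (Pi.single n 1) n' = (starRingEnd ℂ) (A (Pi.single n' 1) n)

/-- `A` commutes with the total boson number. -/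
def ConservesNumber (A : Op Λ) : Prop :=
  Commute A (diag fun n : Config Λ => ∑ i, (n i : ℝ))

/-- `J̄_{i,m}`: the total strength of the monomials of degree `m` in `H₀` that involve the
site `i`. -/
def Jbar (c : Coeffs Λ) (i : Λ) (m : ℕ) : ℝ :=
  ∑ idx : Fin m → Λ with ∃ j, idx j = i, ∑ a : Fin (m + 1), ‖c.J m a idx‖

/-- `𝒥̄ = max_i ∑_{m=1}^k J̄_{i,m} (1 + (2m)^m)`. -/
def calJbar (k : ℕ) (c : Coeffs Λ) : ℝ :=
  ⨆ i : Λ, ∑ m ∈ Finset.Icc 1 k, Jbar c i m * (1 + (2 * (m : ℝ)) ^ m)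

/-- Where the quantum states live: in the full Fock space, or (for a Hamiltonian that conserves the
total boson number) in the subspace with a fixed total number `N` of bosons. -/
inductive Sector where
  | full : Sector
  | fixed (N : ℕ) : Sector

/-- The configurations that belong to a sector. -/
def Sector.configs : Sector → Set (Config Λ)
  | .full => Set.univ
  | .fixed N => {n | ∑ i, n i = N}

/-- A quantum state of the sector `σ`: a unit vector of the Fock space that is supported in the
sector and whose moments `⟨n̂_i^{k/2}⟩` are finite. Finiteness of these moments is the condition for
`⟨ψ|H|ψ⟩` to converge (they define the form domain of `H`); it is automatic in a fixed sector. -/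
def IsState (k : ℕ) (σ : Sector) (ψ : FockSpace Λ) : Prop :=
  ‖ψ‖ = 1 ∧ (∀ n, n ∉ σ.configs → ψ n = 0) ∧
    ∀ i : Λ, Summable fun n : Config Λ => (n i : ℝ) ^ ((k : ℝ) / 2) * ‖ψ n‖ ^ 2

/-- The energy `⟨ψ|H|ψ⟩`. -/
def energy (k : ℕ) (c : Coeffs Λ) (ψ : FockSpace Λ) : ℝ :=
  (expect (hamiltonian k c) ψ).re

/-- The ground energy `E₀` of the sector. -/
def groundEnergy (k : ℕ) (c : Coeffs Λ) (σ : Sector) : EReal :=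
  ⨅ (ψ : FockSpace Λ) (_ : IsState k σ ψ), (energy k c ψ : EReal)

/-- A ground state of the sector: a state of minimal energy. -/
def IsGroundState (k : ℕ) (c : Coeffs Λ) (σ : Sector) (Ω : FockSpace Λ) : Prop :=
  IsState k σ Ω ∧ (energy k c Ω : EReal) = groundEnergy k c σ

/-- `ℰ_Q`: the infimum of the energy over the states of the sector that satisfy
`max_i ⟨n̂_i^{k/2}⟩ = Q^{k/2}` (and `+∞` if there is no such state). -/
def energyAtMoment (k : ℕ) (c : Coeffs Λ) (σ : Sector) (Q : ℝ) : EReal :=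
  ⨅ (ψ : FockSpace Λ) (_ : IsState k σ ψ ∧ (⨆ i : Λ, moment k i ψ) = Q ^ ((k : ℝ) / 2)),
    (energy k c ψ : EReal)

/-- `M_{i,0} = max {2^{2/k} (𝒥̌/U_i)², ((16 𝒥̄ + 𝒥̌)/U_i)²}`. -/
def cutoff (k : ℕ) (c : Coeffs Λ) (Jcheck : ℝ) (i : Λ) : ℝ :=
  max ((2 : ℝ) ^ (2 / (k : ℝ)) * (Jcheck / c.U i) ^ 2)
    (((16 * calJbar k c + Jcheck) / c.U i) ^ 2)

end BoseHubbard

end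

/-! This is an Agmon-type argument. Let `M` be the cutoff, let `f` be the weight `exp((2/k) min((n_i
- M)₊, x - M))`, and put `φ = f(n̂)Ω`. Since `Ω` minimizes the energy, the excess energy of `φ` over
`E₀‖φ‖²` is a double commutator: only the matrix elements of `H` weighted by `(f(n) - f(n'))²`
survive (`IsGroundState.localization`). The diagonal terms and the monomials that avoid site `i`
drop out, and those of degree `k` on `i` are absent.

A monomial moves `n_i` by at most `k`, so `(f - f')² ≤ 8 f f'` (`expWeight_sub_sq_le`). The excess
is therefore controlled by monomials of degree below `k` in `φ` itself. If `g ^ k` is the largest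
moment of the normalized `φ`, it is at most of order `max g 1 ^ (k - 1)` (`norm_commutator_le`). The
assumed energy bound makes it at least `U_i g ^ k - Jcheck * g ^ (k - 1)`. Hence `g` is bounded
independently of `x` (`pow_le_of_repulsion`).

Markov's inequality then bounds the mass of `φ` above `M` by 2. With `T` the tail probability and `y
= 2(x - M)/k`, this says `e^{2y} T ≤ 2`. The same reasoning without weight gives `T ≤ 1/2`, and the
two together give `T ≤ e^{-y}`. -/

namespace BoseHubbard

/-! ### Matrix elements of normally ordered monomials. -/

section

variable {Λ : Type*}

/-- `A` acts by `(A φ)(n) = w(n) φ(τ n)`, where the path from `n` to `τ n` makes one unit step on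
each of the sites in the list `l`. -/
structure IsWeightedShift (l : List Λ) (A : Op Λ) (w : Config Λ → ℝ)
    (τ : Config Λ → Config Λ) : Prop where
  apply : ∀ φ n, A φ n = (w n : ℂ) * φ (τ n)
  nonneg : ∀ n, 0 ≤ w n
  inj : ∀ n n', w n ≠ 0 → w n' ≠ 0 → τ n = τ n' → n = n'
  le_add : ∀ n j, n j ≤ τ n j + l.length
  add_le : ∀ n j, τ n j ≤ n j + l.length
  fixed : ∀ n j, j ∉ l → τ n j = n j
  le_source : ∀ n, w n ≤ (l.map fun j => √((n j : ℝ) + l.length)).prod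
  le_target : ∀ n, w n ≤ (l.map fun j => √((τ n j : ℝ) + l.length)).prod

theorem isWeightedShift_one :
    IsWeightedShift ([] : List Λ) 1 (fun _ => 1) id where
  apply φ n := by simp
  nonneg _ := zero_le_one
  inj _ _ _ _ h := h
  le_add _ _ := by simp
  add_le _ _ := by simp
  fixed _ _ _ := rfl
  le_source _ := by simp
  le_target _ := by simp

theorem isWeightedShift_annihilation [DecidableEq Λ] (i : Λ) :
    IsWeightedShift [i] (annihilation i) (fun n => √((n i : ℝ) + 1))
      (fun n => Function.update n i (n i + 1)) where
  apply φ n := rfl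
  nonneg _ := Real.sqrt_nonneg _
  inj n n' _ _ h := by
    funext j
    have := congrFun h j
    by_cases hj : j = i
    · subst hj; simpa using this
    · simpa [hj] using this
  le_add n j := by
    by_cases hj : j = i
    · subst hj; simp; omega
    · simp [hj]
  add_le n j := by
    by_cases hj : j = i
    · subst hj; simp
    · simp [hj]
  fixed n j hj := by
    have : j ≠ i := by simpa using hj
    simp [this]
  le_source n := by simp
  le_target n := by
    simp only [List.map_cons, List.map_nil, List.prod_cons, List.prod_nil, mul_one]
    apply Real.sqrt_le_sqrt
    simp

theorem isWeightedShift_creation [DecidableEq Λ] (i : Λ) :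
    IsWeightedShift [i] (creation i) (fun n => √(n i : ℝ))
      (fun n => Function.update n i (n i - 1)) where
  apply φ n := rfl
  nonneg _ := Real.sqrt_nonneg _
  -- The truncated subtraction `n i - 1` identifies only the values 0 and 1, and the weight `√(n i)`
  -- vanishes at 0.
  inj n n' hn hn' h := by
    have h1 : n i ≠ 0 := fun h0 => hn (by simp [h0])
    have h2 : n' i ≠ 0 := fun h0 => hn' (by simp [h0])
    funext j
    have := congrFun h j
    by_cases hj : j = i
    · subst hj
      simp only [Function.update_self] at this
      omega
    · simpa [hj] using this
  le_add n j := by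
    by_cases hj : j = i
    · subst hj; simp; omega
    · simp [hj]
  add_le n j := by
    by_cases hj : j = i
    · subst hj; simp; omega
    · simp [hj]
  fixed n j hj := by
    have : j ≠ i := by simpa using hj
    simp [this]
  le_source n := by
    simp only [List.map_cons, List.map_nil, List.prod_cons, List.prod_nil, mul_one]
    apply Real.sqrt_le_sqrt
    simp
  le_target n := by
    simp only [List.map_cons, List.map_nil, List.prod_cons, List.prod_nil, mul_one]
    apply Real.sqrt_le_sqrt
    have : n i ≤ (n i - 1) + 1 := by omega
    simpa using (by exact_mod_cast this : (n i : ℝ) ≤ ((n i - 1 : ℕ) : ℝ) + 1)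

theorem list_prod_sqrt_le {l : List Λ} {n n' : Config Λ} {a b : ℕ}
    (h : ∀ j, n j + a ≤ n' j + b) :
    (l.map fun j => √((n j : ℝ) + a)).prod ≤ (l.map fun j => √((n' j : ℝ) + b)).prod := by
  induction l with
  | nil => simp
  | cons j l ih =>
    simp only [List.map_cons, List.prod_cons]
    have h1 : √((n j : ℝ) + a) ≤ √((n' j : ℝ) + b) :=
      Real.sqrt_le_sqrt (by exact_mod_cast h j)
    have h0 : 0 ≤ (l.map fun j => √((n j : ℝ) + a)).prod :=
      List.prod_nonneg fun x hx => by
        obtain ⟨y, -, rfl⟩ := List.mem_map.1 hx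
        exact Real.sqrt_nonneg _
    exact mul_le_mul h1 ih h0 (Real.sqrt_nonneg _)

/-- Each factor moves an occupation number by at most one, so the offset `length` under the square
roots absorbs the passage from the intermediate configuration to either end of the path. -/
theorem IsWeightedShift.mul {i : Λ} {l : List Λ} {X A : Op Λ} {v w : Config Λ → ℝ}
    {ρ τ : Config Λ → Config Λ} (hX : IsWeightedShift [i] X v ρ) (hA : IsWeightedShift l A w τ) :
    IsWeightedShift (i :: l) (X * A) (fun n => v n * w (ρ n)) (fun n => τ (ρ n)) where
  apply φ n := by
    rw [Module.End.mul_apply, hX.apply, hA.apply]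
    push_cast
    ring
  nonneg n := mul_nonneg (hX.nonneg _) (hA.nonneg _)
  inj n n' hn hn' h :=
    hX.inj n n' (left_ne_zero_of_mul hn) (left_ne_zero_of_mul hn')
      (hA.inj _ _ (right_ne_zero_of_mul hn) (right_ne_zero_of_mul hn') h)
  le_add n j := by
    have h1 := hX.le_add n j
    have h2 := hA.le_add (ρ n) j
    simp only [List.length_cons, List.length_nil] at *
    omega
  add_le n j := by
    have h1 := hX.add_le n j
    have h2 := hA.add_le (ρ n) j
    simp only [List.length_cons, List.length_nil] at *
    omega
  fixed n j hj := by
    rw [List.mem_cons, not_or] at hj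
    rw [hA.fixed _ _ hj.2, hX.fixed _ _ (by simpa using hj.1)]
  le_source n := by
    have h1 := hX.le_source n
    have h2 := (hA.le_source (ρ n)).trans
      (list_prod_sqrt_le (n' := n) (b := l.length + 1) fun j => by
        have := hX.add_le n j
        simp only [List.length_cons, List.length_nil] at this
        omega)
    simp only [List.map_cons, List.map_nil, List.prod_cons, List.prod_nil, mul_one,
      List.length_cons, List.length_nil] at h1 ⊢
    refine mul_le_mul (h1.trans (Real.sqrt_le_sqrt ?_)) h2 (hA.nonneg _) (Real.sqrt_nonneg _)
    push_cast
    have : (0 : ℝ) ≤ l.length := Nat.cast_nonneg _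
    linarith
  le_target n := by
    have h1 := hX.le_target n
    have h2 := (hA.le_target (ρ n)).trans
      (list_prod_sqrt_le (n' := τ (ρ n)) (b := l.length + 1) fun j => by omega)
    simp only [List.map_cons, List.map_nil, List.prod_cons, List.prod_nil, mul_one,
      List.length_cons, List.length_nil] at h1 ⊢
    refine mul_le_mul (h1.trans (Real.sqrt_le_sqrt ?_)) h2 (hA.nonneg _) (Real.sqrt_nonneg _)
    have := hA.le_add (ρ n) i
    push_cast
    have : (ρ n i : ℝ) ≤ τ (ρ n) i + l.length := by exact_mod_cast this
    linarith

theorem exists_isWeightedShift_prod [DecidableEq Λ] (s : List (Bool × Λ)) :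
    ∃ w τ, IsWeightedShift (s.map Prod.snd)
      (s.map fun p => if p.1 then annihilation p.2 else creation p.2).prod w τ := by
  induction s with
  | nil => exact ⟨_, _, isWeightedShift_one⟩
  | cons p s ih =>
    obtain ⟨w, τ, h⟩ := ih
    simp only [List.map_cons, List.prod_cons]
    by_cases hp : p.1 = true
    · rw [if_pos hp]
      exact ⟨_, _, (isWeightedShift_annihilation p.2).mul h⟩
    · rw [if_neg hp]
      exact ⟨_, _, (isWeightedShift_creation p.2).mul h⟩

theorem exists_isWeightedShift_monomial [DecidableEq Λ] [Fintype Λ] {m : ℕ} (a : Fin (m + 1))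
    (idx : Fin m → Λ) :
    ∃ w τ, IsWeightedShift (List.ofFn idx).reverse (monomial a idx) w τ := by
  have h := exists_isWeightedShift_prod
    (List.ofFn fun j : Fin m => (decide ((j : ℕ) < (a : ℕ)), idx j)).reverse
  simpa [monomial, List.map_reverse, List.map_ofFn, Function.comp_def] using h

/-- The bound `∏ₗ √(n_{iₗ} + m)` on the matrix elements of a monomial of degree `m`. -/
noncomputable def ladderWeight {m : ℕ} (idx : Fin m → Λ) (n : Config Λ) : ℝ :=
  ∏ l, √((n (idx l) : ℝ) + m)

theorem ladderWeight_nonneg {m : ℕ} (idx : Fin m → Λ) (n : Config Λ) : 0 ≤ ladderWeight idx n :=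
  Finset.prod_nonneg fun _ _ => Real.sqrt_nonneg _

theorem IsWeightedShift.le_ladderWeight {m : ℕ} {idx : Fin m → Λ} {A : Op Λ} {w : Config Λ → ℝ}
    {τ : Config Λ → Config Λ} (h : IsWeightedShift (List.ofFn idx).reverse A w τ) (n : Config Λ) :
    w n ≤ ladderWeight idx n ∧ w n ≤ ladderWeight idx (τ n) := by
  have h1 := h.le_source n
  have h2 := h.le_target n
  simp only [List.map_reverse, List.prod_reverse, List.map_ofFn, List.prod_ofFn,
    List.length_reverse, List.length_ofFn, Function.comp_def] at h1 h2
  exact ⟨h1, h2⟩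

theorem IsWeightedShift.abs_sub_le {m : ℕ} {idx : Fin m → Λ} {A : Op Λ} {w : Config Λ → ℝ}
    {τ : Config Λ → Config Λ} (h : IsWeightedShift (List.ofFn idx).reverse A w τ) (n : Config Λ)
    (j : Λ) : |(n j : ℝ) - τ n j| ≤ m := by
  have h1 := h.le_add n j
  have h2 := h.add_le n j
  simp only [List.length_reverse, List.length_ofFn] at h1 h2
  rw [abs_le]
  have h1' : (n j : ℝ) ≤ τ n j + m := by exact_mod_cast h1
  have h2' : (τ n j : ℝ) ≤ n j + m := by exact_mod_cast h2
  constructor <;> linarith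

end

/-! ### Bounds on monomials and forms by the moments. -/

section

variable {Λ : Type*}

theorem hasSum_of_forall_eq {ι : Type*} {f g : ι → ℝ} {a : ℝ} (h : HasSum g a)
    (e : ∀ x, f x = g x) : HasSum f a :=
  (funext e : f = g) ▸ h

/-- Weighted AM-GM: each `v l` has weight `1/k`, and an extra factor 1 takes the remaining weight
`(k - m)/k`. -/
theorem prod_le_of_pow {m k : ℕ} (hk : 0 < k) (hm : m ≤ k) (v : Fin m → ℝ) (hv : ∀ l, 0 ≤ v l) :
    ∏ l, v l ≤ ((k : ℝ) - m) / k + (1 / k) * ∑ l, v l ^ k := by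
  have hk' : (0 : ℝ) < k := by exact_mod_cast hk
  have hm' : (m : ℝ) ≤ k := by exact_mod_cast hm
  have h := Real.geom_mean_le_arith_mean_weighted (Finset.univ : Finset (Option (Fin m)))
    (fun o => o.elim (((k : ℝ) - m) / k) fun _ => 1 / k)
    (fun o => o.elim 1 fun l => v l ^ k)
    (by
      rintro (_ | l) -
      · exact div_nonneg (sub_nonneg.2 hm') hk'.le
      · simp)
    (by
      rw [Fintype.sum_option]
      simp
      field_simp
      ring)
    (by
      rintro (_ | l) -
      · simp
      · exact pow_nonneg (hv l) _)
  rw [Fintype.prod_option, Fintype.sum_option] at h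
  simp only [Option.elim_none, Option.elim_some, Real.one_rpow, one_mul, mul_one] at h
  rw [Finset.mul_sum]
  refine le_trans (le_of_eq ?_) h
  refine Finset.prod_congr rfl fun l _ => ?_
  rw [one_div, Real.pow_rpow_inv_natCast (hv l) hk.ne']

theorem rpow_half_eq_sqrt_pow (k : ℕ) {y : ℝ} (hy : 0 ≤ y) : y ^ ((k : ℝ) / 2) = √y ^ k := by
  rw [Real.sqrt_eq_rpow, ← Real.rpow_natCast, ← Real.rpow_mul hy]
  congr 1
  ring

/-- Rescaling each factor by `√(1 + m) * G` before AM-GM makes the bracket have mean at most 1 in a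
state whose moments are at most `G ^ k`. -/
theorem ladderWeight_le {m k : ℕ} (hk : 2 ≤ k) (hm : m ≤ k) {G : ℝ} (hG : 1 ≤ G)
    (idx : Fin m → Λ) (n : Config Λ) :
    ladderWeight idx n ≤ (√(1 + m) * G) ^ m * (((k : ℝ) - m) / k
      + (1 / k) * ∑ l, ((n (idx l) : ℝ) ^ ((k : ℝ) / 2) / G ^ k + m) / (1 + m)) := by
  have hk' : (2 : ℝ) ≤ k := by exact_mod_cast hk
  have hm0 : (0 : ℝ) ≤ m := Nat.cast_nonneg m
  have h1m : (0 : ℝ) < 1 + m := by positivity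
  have hG0 : 0 < G := by linarith
  have hs : 0 < √(1 + (m : ℝ)) := Real.sqrt_pos.2 h1m
  have hprod : ladderWeight idx n = (√(1 + m) * G) ^ m *
      ∏ l, (√((n (idx l) : ℝ) + m) / (√(1 + m) * G)) := by
    rw [Finset.prod_div_distrib, Finset.prod_const, Finset.card_univ, Fintype.card_fin,
      mul_div_cancel₀]
    · rfl
    · positivity
  rw [hprod]
  refine mul_le_mul_of_nonneg_left ?_ (by positivity)
  refine (prod_le_of_pow (by omega) hm _ fun l => by positivity).trans ?_
  refine add_le_add le_rfl (mul_le_mul_of_nonneg_left (Finset.sum_le_sum fun l _ => ?_)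
    (by positivity))
  set y : ℝ := (n (idx l) : ℝ) with hy
  have hy0 : 0 ≤ y := Nat.cast_nonneg _
  have e1 : √(y + m) / (√(1 + m) * G) = √((y + m) / ((1 + m) * G ^ 2)) := by
    rw [Real.sqrt_div (by positivity), Real.sqrt_mul h1m.le, Real.sqrt_sq hG0.le]
  rw [e1, ← rpow_half_eq_sqrt_pow k (by positivity)]
  -- Here `G ≥ 1` allows `m` to be replaced by `m * G ^ 2`. The result is a convex combination of `y
  -- / G ^ 2` and 1, to which convexity of the power `k/2 ≥ 1` applies.
  have hle : (y + m) / ((1 + m) * G ^ 2) ≤ (1 / (1 + m)) * (y / G ^ 2) + (m / (1 + m)) * 1 := by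
    have hG2 : 1 ≤ G ^ 2 := one_le_pow₀ hG
    rw [show (1 / (1 + (m : ℝ))) * (y / G ^ 2) + (m / (1 + m)) * 1
      = (y + m * G ^ 2) / ((1 + m) * G ^ 2) by field_simp]
    gcongr
    nlinarith
  have hconv := (convexOn_rpow (p := (k : ℝ) / 2) (by linarith)).2
    (show y / G ^ 2 ∈ Set.Ici (0 : ℝ) from by simp; positivity)
    (show (1 : ℝ) ∈ Set.Ici (0 : ℝ) from by simp)
    (show 0 ≤ 1 / (1 + (m : ℝ)) by positivity) (show 0 ≤ (m : ℝ) / (1 + m) by positivity)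
    (by field_simp)
  refine (Real.rpow_le_rpow (by positivity) hle (by positivity)).trans ?_
  simp only [smul_eq_mul, Real.one_rpow] at hconv
  refine hconv.trans (le_of_eq ?_)
  rw [Real.div_rpow hy0 (by positivity), rpow_half_eq_sqrt_pow k (sq_nonneg G),
    Real.sqrt_sq hG0.le]
  field_simp

/-- Square summability together with finiteness of all the moments `⟨n̂_j^{k/2}⟩`. -/
structure FiniteMoments (k : ℕ) (φ : Config Λ → ℂ) : Prop where
  sq : Summable fun n => ‖φ n‖ ^ 2
  pow : ∀ j : Λ, Summable fun n => (n j : ℝ) ^ ((k : ℝ) / 2) * ‖φ n‖ ^ 2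

/-- The squared norm of an amplitude function. -/
noncomputable def normSq (φ : Config Λ → ℂ) : ℝ := ∑' n, ‖φ n‖ ^ 2

/-- The unnormalized moment `∑ₙ n_j^{k/2} |φ(n)|²`. -/
noncomputable def rawMoment (k : ℕ) (j : Λ) (φ : Config Λ → ℂ) : ℝ :=
  ∑' n, (n j : ℝ) ^ ((k : ℝ) / 2) * ‖φ n‖ ^ 2

theorem FiniteMoments.ladderWeight_bound {k : ℕ} {φ : Config Λ → ℂ} (hφ : FiniteMoments k φ)
    (hk : 2 ≤ k) {m : ℕ} (hm : m ≤ k) (idx : Fin m → Λ) :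
    (Summable fun n => ladderWeight idx n * ‖φ n‖ ^ 2) ∧
      ∀ G : ℝ, 1 ≤ G → (∀ j, rawMoment k j φ ≤ G ^ k * normSq φ) →
        ∑' n, ladderWeight idx n * ‖φ n‖ ^ 2 ≤ (√(1 + m) * G) ^ m * normSq φ := by
  have hk' : (0 : ℝ) < k := by exact_mod_cast (by omega : 0 < k)
  have key : ∀ G : ℝ, HasSum (fun n => (√(1 + m) * G) ^ m * (((k : ℝ) - m) / k
      + (1 / k) * ∑ l, ((n (idx l) : ℝ) ^ ((k : ℝ) / 2) / G ^ k + m) / (1 + m)) * ‖φ n‖ ^ 2)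
      ((√(1 + m) * G) ^ m * (((k : ℝ) - m) / k * normSq φ
      + (1 / k) * ∑ l, (rawMoment k (idx l) φ / G ^ k + m * normSq φ) / (1 + m))) := by
    intro G
    have h0 : HasSum (fun n => ‖φ n‖ ^ 2) (normSq φ) := hφ.sq.hasSum
    have h1 : ∀ l, HasSum (fun n => (n (idx l) : ℝ) ^ ((k : ℝ) / 2) * ‖φ n‖ ^ 2)
      (rawMoment k (idx l) φ) := fun l => (hφ.pow (idx l)).hasSum
    have h2 := ((h0.mul_left (((k : ℝ) - m) / k)).add
      ((hasSum_sum (s := Finset.univ) fun l _ =>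
        (((h1 l).div_const (G ^ k)).add (h0.mul_left (m : ℝ))).div_const (1 + (m : ℝ))).mul_left
          (1 / (k : ℝ)))).mul_left ((√(1 + m) * G) ^ m)
    refine hasSum_of_forall_eq h2 fun n => ?_
    rw [mul_assoc, add_mul, mul_assoc (1 / (k : ℝ)), Finset.sum_mul]
    congr 3
    refine Finset.sum_congr rfl fun l _ => ?_
    ring
  have hnn : ∀ n, 0 ≤ ladderWeight idx n * ‖φ n‖ ^ 2 := fun n =>
    mul_nonneg (ladderWeight_nonneg _ _) (sq_nonneg _)
  have hle : ∀ G : ℝ, 1 ≤ G → ∀ n, ladderWeight idx n * ‖φ n‖ ^ 2 ≤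
      (√(1 + m) * G) ^ m * (((k : ℝ) - m) / k
      + (1 / k) * ∑ l, ((n (idx l) : ℝ) ^ ((k : ℝ) / 2) / G ^ k + m) / (1 + m)) * ‖φ n‖ ^ 2 :=
    fun G hG n => mul_le_mul_of_nonneg_right (ladderWeight_le hk hm hG idx n) (sq_nonneg _)
  have hs := Summable.of_nonneg_of_le hnn (hle 1 le_rfl) (key 1).summable
  refine ⟨hs, fun G hG hmom => ?_⟩
  refine (hasSum_le (hle G hG) hs.hasSum (key G)).trans ?_
  have hG0 : 0 < G := by linarith
  refine mul_le_mul_of_nonneg_left ?_ (by positivity)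
  have h1 : ∀ l, (rawMoment k (idx l) φ / G ^ k + m * normSq φ) / (1 + m) ≤ normSq φ := by
    intro l
    have : rawMoment k (idx l) φ / G ^ k ≤ normSq φ := by
      rw [div_le_iff₀ (by positivity), mul_comm]
      exact hmom _
    rw [div_le_iff₀ (by positivity)]
    linarith
  have h2 := Finset.sum_le_sum fun l (_ : l ∈ (Finset.univ : Finset (Fin m))) => h1 l
  rw [Finset.sum_const, Finset.card_univ, Fintype.card_fin, nsmul_eq_mul] at h2
  have h3 := mul_le_mul_of_nonneg_left h2 (show 0 ≤ 1 / (k : ℝ) by positivity)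
  calc _ ≤ ((k : ℝ) - m) / k * normSq φ + 1 / k * (m * normSq φ) := by linarith
    _ = normSq φ := by field_simp; ring

/-- A weighted shift is form bounded by its weight. -/
theorem IsWeightedShift.summable_form {m : ℕ} {idx : Fin m → Λ} {A : Op Λ} {w : Config Λ → ℝ}
    {τ : Config Λ → Config Λ} (h : IsWeightedShift (List.ofFn idx).reverse A w τ)
    {χ φ : Config Λ → ℂ} (hχ : Summable fun n => ladderWeight idx n * ‖χ n‖ ^ 2)
    (hφ : Summable fun n => ladderWeight idx n * ‖φ n‖ ^ 2) :
    (Summable fun n => w n * (‖χ n‖ * ‖φ (τ n)‖)) ∧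
      ∑' n, w n * (‖χ n‖ * ‖φ (τ n)‖) ≤
        (∑' n, ladderWeight idx n * ‖χ n‖ ^ 2 + ∑' n, ladderWeight idx n * ‖φ n‖ ^ 2) / 2 := by
  -- On the support `s` of `w` the map `τ` is injective, so summing along `τ` costs at most the full
  -- sum. The rest is `2ab ≤ a² + b²`, with `w` bounded by the ladder weight at `n` for `χ` and at
  -- `τ n` for `φ`.
  set s : Set (Config Λ) := {n | w n ≠ 0}
  have hinj : Function.Injective fun n : s => τ n.1 := fun a b hab =>
    Subtype.ext (h.inj _ _ a.2 b.2 hab)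
  set F : Config Λ → ℝ := fun n => ladderWeight idx n * ‖φ n‖ ^ 2 with hF
  have hF0 : ∀ n, 0 ≤ F n := fun n => mul_nonneg (ladderWeight_nonneg _ _) (sq_nonneg _)
  have h1 : Summable fun n : s => F (τ n.1) := hφ.comp_injective hinj
  have h2 : ∑' n : s, F (τ n.1) ≤ ∑' n, F n :=
    tsum_comp_le_tsum_of_inj hφ hF0 hinj
  have h3 : Summable (s.indicator fun n => F (τ n)) := summable_subtype_iff_indicator.1 h1
  have h4 : ∑' n, s.indicator (fun n => F (τ n)) n ≤ ∑' n, F n := by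
    rw [← tsum_subtype]; exact h2
  have hle : ∀ n, w n * (‖χ n‖ * ‖φ (τ n)‖) ≤
      (ladderWeight idx n * ‖χ n‖ ^ 2 + s.indicator (fun n => F (τ n)) n) / 2 := by
    intro n
    by_cases hn : w n = 0
    · rw [hn, zero_mul, Set.indicator_of_notMem (by simpa [s] using hn), add_zero]
      exact div_nonneg (mul_nonneg (ladderWeight_nonneg _ _) (sq_nonneg _)) zero_le_two
    · rw [Set.indicator_of_mem (show n ∈ s from hn), hF]
      obtain ⟨ha, hb⟩ := h.le_ladderWeight n
      have hw := h.nonneg n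
      have e1 := mul_le_mul_of_nonneg_right ha (sq_nonneg ‖χ n‖)
      have e2 := mul_le_mul_of_nonneg_right hb (sq_nonneg ‖φ (τ n)‖)
      have e3 := mul_nonneg hw (sq_nonneg (‖χ n‖ - ‖φ (τ n)‖))
      simp only
      nlinarith
  have hs := Summable.of_nonneg_of_le
    (fun n => mul_nonneg (h.nonneg n) (by positivity)) hle ((hχ.add h3).div_const 2)
  refine ⟨hs, (hs.tsum_le_tsum hle ((hχ.add h3).div_const 2)).trans ?_⟩
  rw [tsum_div_const, hχ.tsum_add h3]
  linarith

theorem FiniteMoments.diag_mul {k : ℕ} {φ : Config Λ → ℂ} (hφ : FiniteMoments k φ)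
    {f : Config Λ → ℝ} {C : ℝ} (hf : ∀ n, |f n| ≤ C) : FiniteMoments k (diag f φ) := by
  have hle : ∀ n, ‖diag f φ n‖ ^ 2 ≤ C ^ 2 * ‖φ n‖ ^ 2 := by
    intro n
    have : ‖diag f φ n‖ = |f n| * ‖φ n‖ := by simp [diag]
    rw [this, mul_pow]
    gcongr
    exact hf n
  refine ⟨Summable.of_nonneg_of_le (fun n => sq_nonneg _) hle (hφ.sq.mul_left _), fun j =>
    Summable.of_nonneg_of_le (fun n => by positivity) (fun n => ?_) ((hφ.pow j).mul_left (C ^ 2))⟩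
  calc _ ≤ (n j : ℝ) ^ ((k : ℝ) / 2) * (C ^ 2 * ‖φ n‖ ^ 2) := by gcongr; exact hle n
    _ = _ := by ring

theorem FiniteMoments.summable_diag_form {k : ℕ} [Fintype Λ] {χ φ : Config Λ → ℂ}
    (hχ : FiniteMoments k χ) (hφ : FiniteMoments k φ) {D : Config Λ → ℝ} {C : ℝ}
    (hD : ∀ n, |D n| ≤ C * (1 + ∑ j, (n j : ℝ) ^ ((k : ℝ) / 2))) :
    Summable fun n => (starRingEnd ℂ) (χ n) * diag D φ n := by
  have hsum : ∀ {ξ : Config Λ → ℂ}, FiniteMoments k ξ →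
      Summable fun n => C * (1 + ∑ j, (n j : ℝ) ^ ((k : ℝ) / 2)) * ‖ξ n‖ ^ 2 := by
    intro ξ hξ
    have h := (hξ.sq.add (summable_sum fun j (_ : j ∈ Finset.univ) => hξ.pow j)).mul_left C
    refine h.congr fun n => ?_
    rw [mul_assoc, add_mul, one_mul, Finset.sum_mul]
  refine Summable.of_norm (Summable.of_nonneg_of_le (fun n => norm_nonneg _) (fun n => ?_)
    (((hsum hχ).add (hsum hφ)).div_const 2))
  have : ‖(starRingEnd ℂ) (χ n) * diag D φ n‖ = |D n| * (‖χ n‖ * ‖φ n‖) := by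
    simp [diag]; ring
  rw [this]
  have h1 := mul_le_mul_of_nonneg_right (hD n) (show 0 ≤ ‖χ n‖ * ‖φ n‖ by positivity)
  have h2 := mul_nonneg ((abs_nonneg _).trans (hD n)) (sq_nonneg (‖χ n‖ - ‖φ n‖))
  nlinarith

variable [Fintype Λ]

theorem exists_potential_bound (k : ℕ) (c : Coeffs Λ) :
    ∃ C, ∀ n : Config Λ, |∑ m ∈ Finset.Icc 1 (k / 2), ∑ idx : Fin m → Λ,
        c.V m idx * ∏ j, (n (idx j) : ℝ)| ≤ C * (1 + ∑ j, (n j : ℝ) ^ ((k : ℝ) / 2)) := by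
  refine ⟨∑ m ∈ Finset.Icc 1 (k / 2), ∑ idx : Fin m → Λ, |c.V m idx|, fun n => ?_⟩
  rw [Finset.sum_mul]
  refine (Finset.abs_sum_le_sum_abs _ _).trans (Finset.sum_le_sum fun m hm => ?_)
  rw [Finset.sum_mul]
  refine (Finset.abs_sum_le_sum_abs _ _).trans (Finset.sum_le_sum fun idx _ => ?_)
  rw [abs_mul]
  refine mul_le_mul_of_nonneg_left ?_ (abs_nonneg _)
  rw [Finset.mem_Icc] at hm
  have hnn : ∀ j : Λ, 0 ≤ (n j : ℝ) ^ ((k : ℝ) / 2) := fun j => by positivity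
  rw [abs_of_nonneg (Finset.prod_nonneg fun _ _ => Nat.cast_nonneg _)]
  have : Nonempty Λ := ⟨idx ⟨0, hm.1⟩⟩
  obtain ⟨j₀, hj₀⟩ := Finite.exists_max n
  have h1 : ∏ j, (n (idx j) : ℝ) ≤ (n j₀ : ℝ) ^ m := by
    have := Finset.prod_le_pow_card Finset.univ (fun j => n (idx j)) (n j₀) fun j _ => hj₀ _
    rw [Finset.card_univ, Fintype.card_fin] at this
    exact_mod_cast this
  have h2 : (n j₀ : ℝ) ^ m ≤ 1 + (n j₀ : ℝ) ^ ((k : ℝ) / 2) := by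
    rcases Nat.eq_zero_or_pos (n j₀) with h0 | h0
    · rw [h0, Nat.cast_zero, zero_pow (by omega)]
      have := Real.rpow_nonneg (le_refl (0 : ℝ)) ((k : ℝ) / 2)
      linarith
    · have hle : (m : ℝ) ≤ (k : ℝ) / 2 := by
        rw [le_div_iff₀ two_pos]
        exact_mod_cast (by omega : m * 2 ≤ k)
      have := Real.rpow_le_rpow_of_exponent_le (show (1 : ℝ) ≤ n j₀ by exact_mod_cast h0) hle
      rw [Real.rpow_natCast] at this
      linarith
  have h3 := Finset.single_le_sum (fun j _ => hnn j) (Finset.mem_univ j₀)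
  linarith

theorem exists_onsite_bound (k : ℕ) (c : Coeffs Λ) :
    ∃ C, ∀ n : Config Λ, |∑ i, c.U i * (n i : ℝ) ^ ((k : ℝ) / 2)|
      ≤ C * (1 + ∑ j, (n j : ℝ) ^ ((k : ℝ) / 2)) := by
  refine ⟨∑ i, |c.U i|, fun n => ?_⟩
  rw [Finset.sum_mul]
  refine (Finset.abs_sum_le_sum_abs _ _).trans (Finset.sum_le_sum fun i _ => ?_)
  have hnn : ∀ j : Λ, 0 ≤ (n j : ℝ) ^ ((k : ℝ) / 2) := fun j => by positivity
  rw [abs_mul, abs_of_nonneg (hnn i)]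
  refine mul_le_mul_of_nonneg_left ?_ (abs_nonneg _)
  have h3 := Finset.single_le_sum (fun j _ => hnn j) (Finset.mem_univ i)
  linarith

theorem hamiltonian_apply [DecidableEq Λ] (k : ℕ) (c : Coeffs Λ) (φ : Config Λ → ℂ)
    (n : Config Λ) :
    hamiltonian k c φ n = (∑ m ∈ Finset.range (k + 1), ∑ idx : Fin m → Λ, ∑ a : Fin (m + 1),
        c.J m a idx * monomial a idx φ n)
      + diag (fun n => ∑ m ∈ Finset.Icc 1 (k / 2), ∑ idx : Fin m → Λ,
          c.V m idx * ∏ j, (n (idx j) : ℝ)) φ n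
      + diag (fun n => ∑ i, c.U i * (n i : ℝ) ^ ((k : ℝ) / 2)) φ n := by
  simp only [hamiltonian, hopping, LinearMap.add_apply, Pi.add_apply, LinearMap.sum_apply,
    Finset.sum_apply, LinearMap.smul_apply, Pi.smul_apply, smul_eq_mul]

/-- This convergence justifies expanding the energy of trial states term by term in the variational
arguments. -/
theorem FiniteMoments.summable_form [DecidableEq Λ] {k : ℕ} (hk : 2 ≤ k) (c : Coeffs Λ)
    {χ φ : Config Λ → ℂ} (hχ : FiniteMoments k χ) (hφ : FiniteMoments k φ) :
    Summable fun n => (starRingEnd ℂ) (χ n) * hamiltonian k c φ n := by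
  obtain ⟨C₁, h₁⟩ := exists_potential_bound k c
  obtain ⟨C₂, h₂⟩ := exists_onsite_bound k c
  have hhop : Summable fun n => ∑ m ∈ Finset.range (k + 1), ∑ idx : Fin m → Λ,
      ∑ a : Fin (m + 1), c.J m a idx * ((starRingEnd ℂ) (χ n) * monomial a idx φ n) := by
    refine summable_sum fun m hm => summable_sum fun idx _ => summable_sum fun a _ => ?_
    refine Summable.mul_left _ ?_
    have hm' : m ≤ k := by simpa [Nat.lt_succ_iff] using hm
    obtain ⟨w, τ, hw⟩ := exists_isWeightedShift_monomial a idx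
    refine Summable.of_norm ((hw.summable_form (hχ.ladderWeight_bound hk hm' idx).1
      (hφ.ladderWeight_bound hk hm' idx).1).1.congr fun n => ?_)
    rw [hw.apply, norm_mul, norm_mul, Complex.norm_real, Real.norm_of_nonneg (hw.nonneg n),
      RCLike.norm_conj]
    ring
  refine ((hhop.add (hχ.summable_diag_form hφ h₁)).add (hχ.summable_diag_form hφ h₂)).congr
    fun n => ?_
  rw [hamiltonian_apply, mul_add, mul_add, Finset.mul_sum]
  congr 2
  refine Finset.sum_congr rfl fun m _ => ?_
  rw [Finset.mul_sum]
  refine Finset.sum_congr rfl fun idx _ => ?_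
  rw [Finset.mul_sum]
  refine Finset.sum_congr rfl fun a _ => ?_
  ring

end

/-! ### The variational principle and the localization formula. -/

section

variable {Λ : Type*}

theorem norm_diag_apply (f : Config Λ → ℝ) (φ : Config Λ → ℂ) (n : Config Λ) :
    ‖diag f φ n‖ = |f n| * ‖φ n‖ := by
  simp [diag]

theorem eq_zero_of_normSq_eq_zero {φ : Config Λ → ℂ} (hφ : Summable fun n => ‖φ n‖ ^ 2)
    (h : normSq φ = 0) : φ = 0 := by
  have h0 : HasSum (fun n => ‖φ n‖ ^ 2) 0 := h ▸ hφ.hasSum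
  have := (hasSum_zero_iff_of_nonneg fun n => sq_nonneg ‖φ n‖).1 h0
  funext n
  have hn := congrFun this n
  simpa using hn

theorem normSq_nonneg (φ : Config Λ → ℂ) : 0 ≤ normSq φ := tsum_nonneg fun _ => sq_nonneg _

theorem expect_diag (g : Config Λ → ℝ) (φ : Config Λ → ℂ) :
    expect (diag g) φ = ((∑' n, g n * ‖φ n‖ ^ 2 : ℝ) : ℂ) := by
  rw [expect, Complex.ofReal_tsum]
  refine tsum_congr fun n => ?_
  simp only [diag, LinearMap.coe_mk, AddHom.coe_mk]
  rw [mul_left_comm, Complex.conj_mul']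
  push_cast
  rfl

theorem moment_eq_rawMoment (k : ℕ) (j : Λ) (φ : Config Λ → ℂ) :
    moment k j φ = rawMoment k j φ := by
  rw [moment, expect_diag, Complex.ofReal_re, rawMoment]

theorem expect_smul (A : Op Λ) (a : ℝ) (φ : Config Λ → ℂ) :
    expect A ((a : ℂ) • φ) = (a : ℂ) ^ 2 * expect A φ := by
  rw [expect, expect, ← tsum_mul_left]
  refine tsum_congr fun n => ?_
  rw [map_smul]
  simp only [Pi.smul_apply, smul_eq_mul, map_mul, Complex.conj_ofReal]
  ring

theorem normSq_lp (Ω : FockSpace Λ) : Summable (fun n => ‖Ω n‖ ^ 2) ∧ normSq Ω = ‖Ω‖ ^ 2 := by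
  have h := lp.hasSum_norm (p := 2) (by norm_num) Ω
  simp only [ENNReal.toReal_ofNat, Real.rpow_ofNat] at h
  exact ⟨h.summable, h.tsum_eq⟩

variable [Fintype Λ] {k : ℕ} {c : Coeffs Λ} {σ : Sector}

theorem IsState.finiteMoments {Ω : FockSpace Λ} (h : IsState k σ Ω) : FiniteMoments k Ω :=
  ⟨(normSq_lp Ω).1, h.2.2⟩

theorem IsState.normSq_eq_one {Ω : FockSpace Λ} (h : IsState k σ Ω) : normSq Ω = 1 := by
  rw [(normSq_lp Ω).2, h.1, one_pow]

theorem exists_max_rawMoment [Nonempty Λ] (hk : k ≠ 0) {φ : Config Λ → ℂ} (hN : 0 < normSq φ) :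
    ∃ g : ℝ, 0 ≤ g ∧ (∀ j, rawMoment k j φ ≤ g ^ k * normSq φ) ∧
      ∃ j, rawMoment k j φ = g ^ k * normSq φ := by
  obtain ⟨j₀, hj₀⟩ := Finite.exists_max fun j => rawMoment k j φ
  have h0 : 0 ≤ rawMoment k j₀ φ / normSq φ :=
    div_nonneg (tsum_nonneg fun n => by positivity) hN.le
  have h1 : ((rawMoment k j₀ φ / normSq φ) ^ ((k : ℝ)⁻¹)) ^ k * normSq φ = rawMoment k j₀ φ := by
    rw [Real.rpow_inv_natCast_pow h0 hk, div_mul_cancel₀ _ hN.ne']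
  exact ⟨_, Real.rpow_nonneg h0 _, fun j => (hj₀ j).trans_eq h1.symm, j₀, h1.symm⟩

variable [DecidableEq Λ]

/-- Normalizing a nonzero amplitude function with finite moments yields a state. -/
theorem FiniteMoments.exists_state {φ : Config Λ → ℂ} (hφ : FiniteMoments k φ)
    (hσ : ∀ n, n ∉ σ.configs → φ n = 0) (hN : 0 < normSq φ) (c : Coeffs Λ) :
    ∃ ψ : FockSpace Λ, IsState k σ ψ ∧
      energy k c ψ * normSq φ = (expect (hamiltonian k c) φ).re ∧
      ∀ j, moment k j ψ * normSq φ = rawMoment k j φ := by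
  set a : ℝ := (√(normSq φ))⁻¹ with ha
  have ha2 : a ^ 2 * normSq φ = 1 := by
    rw [ha, inv_pow, Real.sq_sqrt hN.le, inv_mul_cancel₀ hN.ne']
  have hn : ∀ n, ‖((a : ℂ) • φ) n‖ ^ 2 = a ^ 2 * ‖φ n‖ ^ 2 := fun n => by
    simp [mul_pow]
  have hs : Summable fun n => ‖((a : ℂ) • φ) n‖ ^ 2 := by
    simp only [hn]
    exact hφ.sq.mul_left _
  have hmem : Memℓp ((a : ℂ) • φ) 2 := memℓp_gen (by simpa using hs)
  let ψ : FockSpace Λ := ⟨(a : ℂ) • φ, hmem⟩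
  have hψ : (ψ : Config Λ → ℂ) = (a : ℂ) • φ := rfl
  refine ⟨ψ, ⟨?_, fun n hn' => ?_, fun j => ?_⟩, ?_, fun j => ?_⟩
  · have h1 : ‖ψ‖ ^ 2 = 1 := by
      rw [← (normSq_lp ψ).2, hψ, normSq]
      simp only [hn]
      rw [tsum_mul_left]
      exact ha2
    exact (pow_eq_one_iff_of_nonneg (norm_nonneg _) two_ne_zero).1 h1
  · rw [hψ, Pi.smul_apply, hσ n hn', smul_zero]
  · refine ((hφ.pow j).mul_left (a ^ 2)).congr fun n => ?_
    rw [hψ, hn]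
    ring
  · rw [energy, hψ, expect_smul, ← Complex.ofReal_pow, Complex.re_ofReal_mul, mul_right_comm, ha2,
      one_mul]
  · rw [moment, hψ, expect_smul, ← Complex.ofReal_pow, Complex.re_ofReal_mul, mul_right_comm, ha2,
      one_mul]
    exact moment_eq_rawMoment k j φ

theorem IsGroundState.energy_mul_normSq_le {Ω : FockSpace Λ} (hΩ : IsGroundState k c σ Ω)
    {φ : Config Λ → ℂ} (hφ : FiniteMoments k φ) (hσ : ∀ n, n ∉ σ.configs → φ n = 0) :
    energy k c Ω * normSq φ ≤ (expect (hamiltonian k c) φ).re := by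
  rcases (normSq_nonneg φ).eq_or_lt with h0 | hpos
  · rw [← h0, eq_zero_of_normSq_eq_zero hφ.sq h0.symm]
    simp [expect]
  · obtain ⟨ψ, hψ, he, -⟩ := hφ.exists_state hσ hpos c
    rw [← he]
    refine mul_le_mul_of_nonneg_right ?_ hpos.le
    have h1 : groundEnergy k c σ ≤ (energy k c ψ : EReal) := iInf₂_le ψ hψ
    rw [← hΩ.2] at h1
    exact EReal.coe_le_coe_iff.1 h1

/-- The assumed bound is applied to the normalized `φ` at `Q = g ^ 2`, so that the half-integer
powers of `Q` become integer powers of `g`. -/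
theorem IsGroundState.repulsion_le {Ω : FockSpace Λ} (hΩ : IsGroundState k c σ Ω) (hk : 1 ≤ k)
    {Jcheck u : ℝ}
    (hJ : ∀ Q : ℝ, 0 < Q → groundEnergy k c σ
        + ((u * Q ^ ((k : ℝ) / 2) - Jcheck * Q ^ (((k : ℝ) - 1) / 2) : ℝ) : EReal)
        ≤ energyAtMoment k c σ Q)
    {φ : Config Λ → ℂ} (hφ : FiniteMoments k φ) (hσ : ∀ n, n ∉ σ.configs → φ n = 0)
    (hN : 0 < normSq φ) {g : ℝ} (hg : 0 < g) (hle : ∀ j, rawMoment k j φ ≤ g ^ k * normSq φ)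
    (heq : ∃ j, rawMoment k j φ = g ^ k * normSq φ) :
    (energy k c Ω + (u * g ^ k - Jcheck * g ^ (k - 1))) * normSq φ
      ≤ (expect (hamiltonian k c) φ).re := by
  obtain ⟨ψ, hψ, he, hm⟩ := hφ.exists_state hσ hN c
  rw [← he]
  refine mul_le_mul_of_nonneg_right ?_ hN.le
  have hpow : ∀ d : ℕ, (g ^ 2) ^ ((d : ℝ) / 2) = g ^ d := fun d => by
    rw [rpow_half_eq_sqrt_pow d (sq_nonneg g), Real.sqrt_sq hg.le]
  have hk1 : ((k : ℝ) - 1) = ((k - 1 : ℕ) : ℝ) := by push_cast [hk]; rfl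
  have h1 := hJ (g ^ 2) (by positivity)
  rw [hk1, hpow, hpow, ← hΩ.2] at h1
  obtain ⟨j₀, hj₀⟩ := heq
  have : Nonempty Λ := ⟨j₀⟩
  have hsup : (⨆ j : Λ, moment k j ψ) = (g ^ 2) ^ ((k : ℝ) / 2) := by
    rw [hpow]
    refine le_antisymm (ciSup_le fun j => ?_) ?_
    · exact le_of_mul_le_mul_right ((hm j).trans_le (hle j)) hN
    · have : g ^ k = moment k j₀ ψ := mul_right_cancel₀ hN.ne' (hj₀.symm.trans (hm j₀).symm)
      rw [this]
      exact le_ciSup (f := fun j => moment k j ψ) (Set.finite_range _).bddAbove j₀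
  have h2 : energyAtMoment k c σ (g ^ 2) ≤ (energy k c ψ : EReal) := iInf₂_le ψ ⟨hψ, hsup⟩
  have h3 := h1.trans h2
  rw [← EReal.coe_add] at h3
  exact EReal.coe_le_coe_iff.1 h3

/-- The sesquilinear form `⟨χ|A|φ⟩`. -/
noncomputable def form (A : Op Λ) (χ φ : Config Λ → ℂ) : ℂ :=
  ∑' n, (starRingEnd ℂ) (χ n) * A φ n

theorem eq_zero_of_forall_quadratic_nonneg {b d : ℝ} (h : ∀ t : ℝ, 0 ≤ t * b + t ^ 2 * d) :
    b = 0 := by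
  have h1 := discrim_le_zero (a := d) (b := b) (c := 0) fun t => by
    have := h t
    nlinarith
  rw [discrim] at h1
  nlinarith [sq_nonneg b]

/-- The first variation of the energy at a ground state `Ω` in the direction `h(n̂) Ω`. -/
theorem IsGroundState.first_variation {Ω : FockSpace Λ} (hΩ : IsGroundState k c σ Ω)
    (hk : 2 ≤ k) {h : Config Λ → ℝ} {C : ℝ} (hC : ∀ n, |h n| ≤ C) :
    (form (hamiltonian k c) (diag h Ω) Ω).re + (form (hamiltonian k c) Ω (diag h Ω)).re
      = 2 * energy k c Ω * ∑' n, h n * ‖Ω n‖ ^ 2 := by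
  set H := hamiltonian k c
  set ψ : Config Λ → ℂ := ⇑Ω with hψ
  have hm : FiniteMoments k ψ := hΩ.1.finiteMoments
  have hh : FiniteMoments k (diag h ψ) := hm.diag_mul hC
  have s1 : Summable fun n => h n * ‖ψ n‖ ^ 2 := by
    refine Summable.of_norm (Summable.of_nonneg_of_le (fun n => norm_nonneg _) (fun n => ?_)
      (hm.sq.mul_left C))
    rw [norm_mul, Real.norm_eq_abs, Real.norm_of_nonneg (sq_nonneg _)]
    exact mul_le_mul_of_nonneg_right (hC n) (sq_nonneg _)
  have hN : ∀ t : ℝ, HasSum (fun n => ‖diag (fun n => 1 + t * h n) ψ n‖ ^ 2)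
      (normSq ψ + t * (2 * ∑' n, h n * ‖ψ n‖ ^ 2) + t ^ 2 * normSq (diag h ψ)) := by
    intro t
    have := (hm.sq.hasSum.add ((s1.hasSum.mul_left 2).mul_left t)).add
      (hh.sq.hasSum.mul_left (t ^ 2))
    refine hasSum_of_forall_eq this fun n => ?_
    rw [norm_diag_apply, norm_diag_apply, mul_pow, mul_pow, sq_abs, sq_abs]
    ring
  have f00 := (hm.summable_form hk c hm).hasSum
  have f10 := (hh.summable_form hk c hm).hasSum
  have f01 := (hm.summable_form hk c hh).hasSum
  have f11 := (hh.summable_form hk c hh).hasSum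
  have hE : ∀ t : ℝ, expect H (diag (fun n => 1 + t * h n) ψ)
      = expect H ψ + (t : ℂ) * (form H (diag h ψ) ψ + form H ψ (diag h ψ))
        + (t ^ 2 : ℝ) * expect H (diag h ψ) := by
    intro t
    have hd : diag (fun n => 1 + t * h n) ψ = ψ + (t : ℂ) • diag h ψ := by
      funext n
      simp [diag]
      ring
    have := (f00.add ((f10.add f01).mul_left (t : ℂ))).add (f11.mul_left ((t ^ 2 : ℝ) : ℂ))
    rw [expect]
    refine Eq.trans (tsum_congr fun n => ?_) this.tsum_eq
    rw [hd, map_add, map_smul]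
    simp only [Pi.add_apply, Pi.smul_apply, smul_eq_mul, map_add, map_mul, Complex.conj_ofReal]
    push_cast
    ring
  -- The trial function is `(1 + t h)Ω`, which stays in the sector because `h` is diagonal. The
  -- terms of order zero in `t` cancel, so the linear coefficient must vanish.
  have key : ∀ t : ℝ, 0 ≤ t * ((form H (diag h ψ) ψ).re + (form H ψ (diag h ψ)).re
      - 2 * energy k c Ω * ∑' n, h n * ‖ψ n‖ ^ 2)
      + t ^ 2 * ((expect H (diag h ψ)).re - energy k c Ω * normSq (diag h ψ)) := by
    intro t
    have hb : ∀ n, |1 + t * h n| ≤ 1 + |t| * C := fun n =>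
      (abs_add_le _ _).trans (by rw [abs_one, abs_mul]; gcongr; exact hC n)
    have h1 := hΩ.energy_mul_normSq_le (φ := diag (fun n => 1 + t * h n) ψ) (hm.diag_mul hb)
      (fun n hn => by simp [diag, hψ, hΩ.1.2.1 n hn])
    rw [normSq, (hN t).tsum_eq, hE t] at h1
    have h2 : (expect H ψ).re = energy k c Ω := rfl
    have h3 : normSq ψ = 1 := hΩ.1.normSq_eq_one
    simp only [Complex.add_re, Complex.re_ofReal_mul, h2, h3] at h1
    nlinarith
  have := eq_zero_of_forall_quadratic_nonneg key
  linarith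

/-- The localization formula: the excess energy of `f(n̂) Ω` is a double commutator. -/
theorem IsGroundState.localization {Ω : FockSpace Λ} (hΩ : IsGroundState k c σ Ω)
    (hk : 2 ≤ k) {f : Config Λ → ℝ} {C : ℝ} (hC : ∀ n, |f n| ≤ C) :
    (expect (hamiltonian k c) (diag f Ω)).re - energy k c Ω * normSq (diag f Ω)
      = -(1 / 2) * (∑' n, (starRingEnd ℂ) (Ω n) *
          hamiltonian k c (diag (fun n' => (f n - f n') ^ 2) Ω) n).re := by
  set H := hamiltonian k c with hH
  set ψ : Config Λ → ℂ := ⇑Ω with hψ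
  have hC2 : ∀ n, |f n ^ 2| ≤ C ^ 2 := fun n => by
    rw [abs_pow]
    exact pow_le_pow_left₀ (abs_nonneg _) (hC n) 2
  have hm : FiniteMoments k ψ := hΩ.1.finiteMoments
  have hf : FiniteMoments k (diag f ψ) := hm.diag_mul hC
  have hff : FiniteMoments k (diag (fun n => f n ^ 2) ψ) := hm.diag_mul hC2
  have f10 := (hff.summable_form hk c hm).hasSum
  have f01 := (hm.summable_form hk c hff).hasSum
  have f11 := (hf.summable_form hk c hf).hasSum
  have hN : normSq (diag f ψ) = ∑' n, f n ^ 2 * ‖ψ n‖ ^ 2 := by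
    refine tsum_congr fun n => ?_
    rw [norm_diag_apply, mul_pow, sq_abs]
  have hK : ∑' n, (starRingEnd ℂ) (ψ n) * H (diag (fun n' => (f n - f n') ^ 2) ψ) n
      = form H (diag (fun n => f n ^ 2) ψ) ψ + form H ψ (diag (fun n => f n ^ 2) ψ)
        - 2 * expect H (diag f ψ) := by
    refine Eq.trans (tsum_congr fun n => ?_) ((f10.add f01).sub (f11.mul_left 2)).tsum_eq
    -- With `n` frozen, the square expands as `f(n)² - 2 f(n) f(n') + f(n')²`. The outer terms are
    -- the first variation in the direction `f² Ω`; the middle one is the energy of `f Ω`.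
    have hd : diag (fun n' => (f n - f n') ^ 2) ψ
        = ((f n : ℂ) ^ 2) • ψ - (2 * (f n : ℂ)) • diag f ψ + diag (fun n => f n ^ 2) ψ := by
      funext n'
      simp [diag]
      ring
    rw [hd, map_add, map_sub, map_smul, map_smul, ← hH]
    simp only [diag, LinearMap.coe_mk, AddHom.coe_mk, Pi.add_apply, Pi.sub_apply, Pi.smul_apply,
      smul_eq_mul, map_mul, Complex.conj_ofReal]
    push_cast
    ring
  have h1 := hΩ.first_variation hk hC2
  rw [hK, hN, Complex.sub_re, Complex.add_re]
  have : (2 * expect H (diag f ψ)).re = 2 * (expect H (diag f ψ)).re := by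
    simp
  rw [this]
  linarith

end

/-! ### The double commutator, the numerical inequality and the weight. -/

section

variable {Λ : Type*} [Fintype Λ] [DecidableEq Λ] {k : ℕ} {c : Coeffs Λ} {σ : Sector}

theorem Jbar_nonneg (c : Coeffs Λ) (i : Λ) (m : ℕ) : 0 ≤ Jbar c i m :=
  Finset.sum_nonneg fun _ _ => Finset.sum_nonneg fun _ _ => norm_nonneg _

theorem Jbar_zero (c : Coeffs Λ) (i : Λ) : Jbar c i 0 = 0 := by
  simp [Jbar]

theorem sum_Jbar_le_calJbar (k : ℕ) (c : Coeffs Λ) (i : Λ) :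
    ∑ m ∈ Finset.range (k + 1), Jbar c i m * (1 + (2 * (m : ℝ)) ^ m) ≤ calJbar k c := by
  have h : ∑ m ∈ Finset.range (k + 1), Jbar c i m * (1 + (2 * (m : ℝ)) ^ m)
      = ∑ m ∈ Finset.Icc 1 k, Jbar c i m * (1 + (2 * (m : ℝ)) ^ m) := by
    symm
    refine Finset.sum_subset (fun m hm => ?_) fun m hm hm' => ?_
    · simp only [Finset.mem_Icc, Finset.mem_range] at *
      omega
    · have : m = 0 := by
        simp only [Finset.mem_Icc, Finset.mem_range] at *
        omega
      rw [this, Jbar_zero, zero_mul]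
  rw [h]
  exact le_ciSup (f := fun i => ∑ m ∈ Finset.Icc 1 k, Jbar c i m * (1 + (2 * (m : ℝ)) ^ m))
    (Set.finite_range _).bddAbove i

theorem calJbar_nonneg (k : ℕ) (c : Coeffs Λ) (i : Λ) : 0 ≤ calJbar k c :=
  (Finset.sum_nonneg fun m _ => mul_nonneg (Jbar_nonneg c i m) (by positivity)).trans
    (sum_Jbar_le_calJbar k c i)

/-- Uses `1 + m ≤ 2m` and `2t ≤ 1 + t²` with `t = (2m)^{m/2}`; this is where the factor `1 + (2m)^m`
in `calJbar` comes from. -/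
theorem sqrt_mul_pow_le {m k : ℕ} (hm : 1 ≤ m) (hmk : m < k) {G : ℝ} (hG : 1 ≤ G) :
    (√(1 + m) * G) ^ m ≤ (1 + (2 * (m : ℝ)) ^ m) / 2 * G ^ (k - 1) := by
  have hm' : (1 : ℝ) ≤ m := by exact_mod_cast hm
  rw [mul_pow]
  refine mul_le_mul ?_ (pow_le_pow_right₀ hG (by omega)) (by positivity) (by positivity)
  have h1 : √(1 + (m : ℝ)) ^ m ≤ √(2 * m) ^ m :=
    pow_le_pow_left₀ (Real.sqrt_nonneg _) (Real.sqrt_le_sqrt (by linarith)) m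
  have h2 : (√(2 * (m : ℝ)) ^ m) ^ 2 = (2 * m) ^ m := by
    rw [← pow_mul, mul_comm m 2, pow_mul, Real.sq_sqrt (by positivity)]
  nlinarith [sq_nonneg (√(2 * (m : ℝ)) ^ m - 1)]

/-- The double commutator of the Hamiltonian with a slowly varying function of the occupation of a
site `i` without couplings of maximal degree. -/
theorem norm_commutator_le (hk : 2 ≤ k) {i : Λ} (hi : Jbar c i k = 0) {F : ℝ → ℝ}
    (hF0 : ∀ a, 0 ≤ F a) (hF : ∀ a b, |a - b| ≤ (k : ℝ) → (F a - F b) ^ 2 ≤ 8 * (F a * F b))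
    {ψ : Config Λ → ℂ} (hφ : FiniteMoments k (diag (fun n => F (n i)) ψ)) {G : ℝ} (hG : 1 ≤ G)
    (hmom : ∀ j, rawMoment k j (diag (fun n => F (n i)) ψ)
      ≤ G ^ k * normSq (diag (fun n => F (n i)) ψ)) :
    ‖∑' n, (starRingEnd ℂ) (ψ n) *
        hamiltonian k c (diag (fun n' => (F (n i) - F (n' i)) ^ 2) ψ) n‖
      ≤ 4 * calJbar k c * G ^ (k - 1) * normSq (diag (fun n => F (n i)) ψ) := by
  set φ := diag (fun n => F (n i)) ψ with hφdef
  have hφn : ∀ n, ‖φ n‖ = F (n i) * ‖ψ n‖ := fun n => by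
    rw [hφdef, norm_diag_apply, abs_of_nonneg (hF0 _)]
  choose w τ hw using fun (m : ℕ) (idx : Fin m → Λ) (a : Fin (m + 1)) =>
    exists_isWeightedShift_monomial a idx
  set B : (m : ℕ) → (Fin m → Λ) → Fin (m + 1) → Config Λ → ℝ := fun m idx a n =>
    if ∃ j, idx j = i then
      ‖c.J m a idx‖ * (8 * (w m idx a n * (‖φ n‖ * ‖φ (τ m idx a n)‖))) else 0 with hB
  have hterm : ∀ n, ‖(starRingEnd ℂ) (ψ n) *
      hamiltonian k c (diag (fun n' => (F (n i) - F (n' i)) ^ 2) ψ) n‖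
      ≤ ∑ m ∈ Finset.range (k + 1), ∑ idx : Fin m → Λ, ∑ a : Fin (m + 1), B m idx a n := by
    intro n
    -- The potential terms preserve `n`, where the weight `(F (n i) - F (n i)) ^ 2` is zero.
    have hd : ∀ D : Config Λ → ℝ,
        diag D (diag (fun n' => (F (n i) - F (n' i)) ^ 2) ψ) n = 0 := fun D => by
      simp [diag]
    rw [hamiltonian_apply, hd, hd, add_zero, add_zero, Finset.mul_sum]
    refine (norm_sum_le _ _).trans (Finset.sum_le_sum fun m hm => ?_)
    rw [Finset.mul_sum]
    refine (norm_sum_le _ _).trans (Finset.sum_le_sum fun idx _ => ?_)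
    rw [Finset.mul_sum]
    refine (norm_sum_le _ _).trans (Finset.sum_le_sum fun a _ => ?_)
    have hm' : m ≤ k := by simpa [Nat.lt_succ_iff] using hm
    have hs := hw m idx a
    rw [hs.apply, norm_mul, norm_mul, norm_mul, RCLike.norm_conj, norm_diag_apply,
      Complex.norm_real, Real.norm_of_nonneg (hs.nonneg n), abs_of_nonneg (sq_nonneg _), hB]
    simp only
    split_ifs with hidx
    · have h1 := hF (n i) (τ m idx a n i)
        ((hs.abs_sub_le n i).trans (by exact_mod_cast hm'))
      rw [hφn, hφn]
      have h2 : 0 ≤ ‖c.J m a idx‖ * w m idx a n * ‖ψ n‖ * ‖ψ (τ m idx a n)‖ :=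
        mul_nonneg (mul_nonneg (mul_nonneg (norm_nonneg _) (hs.nonneg n)) (norm_nonneg _))
          (norm_nonneg _)
      have h3 := mul_le_mul_of_nonneg_left h1 h2
      linarith
    -- A monomial that avoids site `i` leaves `n i` fixed, so its weight vanishes too.
    · have : τ m idx a n i = n i := hs.fixed n i (by
        simpa [List.mem_reverse, List.mem_ofFn] using hidx)
      rw [this]
      simp
  have hBsum : ∀ m ∈ Finset.range (k + 1), ∀ idx a, Summable (B m idx a) ∧
      ∑' n, B m idx a n ≤ if ∃ j, idx j = i then
        ‖c.J m a idx‖ * (8 * ((√(1 + m) * G) ^ m * normSq φ)) else 0 := by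
    intro m hm idx a
    have hm' : m ≤ k := by simpa [Nat.lt_succ_iff] using hm
    obtain ⟨h1, h2⟩ := hφ.ladderWeight_bound hk hm' idx
    obtain ⟨h3, h4⟩ := (hw m idx a).summable_form h1 h1
    have h5 := h2 G hG hmom
    by_cases hidx : ∃ j, idx j = i
    · simp only [hB, if_pos hidx]
      refine ⟨(h3.mul_left 8).mul_left _, ?_⟩
      rw [tsum_mul_left, tsum_mul_left]
      refine mul_le_mul_of_nonneg_left ?_ (norm_nonneg _)
      linarith
    · simp only [hB, if_neg hidx]
      exact ⟨summable_zero, by simp⟩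
  have hsum : Summable fun n => ∑ m ∈ Finset.range (k + 1), ∑ idx : Fin m → Λ,
      ∑ a : Fin (m + 1), B m idx a n :=
    summable_sum fun m hm => summable_sum fun idx _ => summable_sum fun a _ =>
      (hBsum m hm idx a).1
  refine (tsum_of_norm_bounded hsum.hasSum hterm).trans ?_
  rw [Summable.tsum_finsetSum fun m hm => summable_sum fun idx _ => summable_sum fun a _ =>
      (hBsum m hm idx a).1]
  have hm_le : ∀ m ∈ Finset.range (k + 1),
      ∑' n, ∑ idx : Fin m → Λ, ∑ a : Fin (m + 1), B m idx a n
        ≤ 4 * G ^ (k - 1) * normSq φ * (Jbar c i m * (1 + (2 * (m : ℝ)) ^ m)) := by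
    intro m hm
    rw [Summable.tsum_finsetSum fun idx _ => summable_sum fun a _ => (hBsum m hm idx a).1]
    have h1 : ∑ idx : Fin m → Λ, ∑' n, ∑ a : Fin (m + 1), B m idx a n
        ≤ Jbar c i m * (8 * ((√(1 + m) * G) ^ m * normSq φ)) := by
      rw [Jbar, Finset.sum_filter, Finset.sum_mul]
      refine Finset.sum_le_sum fun idx _ => ?_
      rw [Summable.tsum_finsetSum fun a _ => (hBsum m hm idx a).1, ite_mul, zero_mul]
      refine (Finset.sum_le_sum fun a _ => (hBsum m hm idx a).2).trans (le_of_eq ?_)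
      split_ifs
      · rw [Finset.sum_mul]
      · simp
    refine h1.trans ?_
    rcases Nat.eq_zero_or_pos m with h0 | h0
    · subst h0
      rw [Jbar_zero, zero_mul, zero_mul, mul_zero]
    -- Without terms of degree `k` on site `i`, every remaining degree is at most `k - 1`, which
    -- yields the power `G ^ (k - 1)`.
    rcases eq_or_ne m k with hmk | hmk
    · rw [hmk, hi, zero_mul, zero_mul, mul_zero]
    have hlt : m < k := by
      rw [Finset.mem_range] at hm
      omega
    have h2 := sqrt_mul_pow_le h0 hlt hG
    have h3 := mul_le_mul_of_nonneg_left h2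
      (mul_nonneg (Jbar_nonneg c i m) (normSq_nonneg φ))
    linarith
  refine (Finset.sum_le_sum hm_le).trans ?_
  rw [← Finset.mul_sum]
  have hG' : 0 ≤ 4 * G ^ (k - 1) * normSq φ :=
    mul_nonneg (by positivity) (normSq_nonneg φ)
  exact (mul_le_mul_of_nonneg_left (sum_Jbar_le_calJbar k c i) hG').trans (le_of_eq (by ring))

/-- Here `r = Jcheck / U_i`, `s = calJbar / U_i`, `μ = √M` and `b = 2^{1/k}`; the two branches of
the maximum in `cutoff` are `h1` and `h2`. Dividing by `g ^ (k - 1)` gives `g ≤ r + 3s`, and a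
combination of `h1` and `h2` turns this into the claim. -/
theorem pow_le_of_repulsion {k : ℕ} (hk : 3 ≤ k) {r s μ b g : ℝ} (hr : 0 ≤ r) (hs : 0 ≤ s)
    (hb0 : 0 ≤ b) (hb : b ^ k = 2) (h1 : b * r ≤ μ) (h2 : r + 16 * s ≤ μ) (hg : 0 < g)
    (h : g ^ k ≤ r * g ^ (k - 1) + 2 * s * max g 1 ^ (k - 1)) :
    g ^ k ≤ 2 / 3 * max μ 1 ^ k := by
  by_contra! hcon
  have hμ0 : 0 ≤ μ := by linarith
  have hk0 : k ≠ 0 := by omega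
  have hmu : μ ^ k ≤ max μ 1 ^ k := pow_le_pow_left₀ hμ0 (le_max_left _ _) k
  have hmu1 : 1 ≤ max μ 1 ^ k := one_le_pow₀ (le_max_right _ _)
  have hgk : g ^ k = g * g ^ (k - 1) := by
    rw [← pow_succ', Nat.sub_add_cancel (by omega)]
  have hpos : 0 < g ^ (k - 1) := by positivity
  -- If `g ≤ 1`, the negated claim gives `g ^ (k - 1) ≥ g ^ k > 2/3`.
  have hmax : max g 1 ^ (k - 1) ≤ 3 / 2 * g ^ (k - 1) := by
    rcases le_total 1 g with hg1 | hg1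
    · rw [max_eq_left hg1]; linarith
    · rw [max_eq_right hg1, one_pow]
      have : g ^ k ≤ g ^ (k - 1) := pow_le_pow_of_le_one hg.le hg1 (by omega)
      linarith
  have hgle : g ≤ r + 3 * s := by
    have h3 := mul_le_mul_of_nonneg_left hmax (show 0 ≤ 2 * s by linarith)
    rw [hgk] at h
    refine le_of_mul_le_mul_right ?_ hpos
    linarith
  have hrs : g ^ k ≤ (r + 3 * s) ^ k := pow_le_pow_left₀ hg.le hgle k
  set v : ℝ := (4 / 3 : ℝ) ^ ((k : ℝ)⁻¹) with hv
  have hvk : v ^ k = 4 / 3 := Real.rpow_inv_natCast_pow (by norm_num) hk0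
  have hv0 : 0 ≤ v := Real.rpow_nonneg (by norm_num) _
  have hv1 : 1 ≤ v := by
    by_contra! hlt
    have := pow_lt_one₀ hv0 hlt hk0
    linarith
  have hv2 : v ≤ 4 / 3 := by
    have := le_self_pow₀ hv1 hk0
    linarith
  have hbv : b ≤ v ^ 3 := by
    refine le_of_pow_le_pow_left₀ hk0 (by positivity) ?_
    rw [hb, ← pow_mul, mul_comm, pow_mul, hvk]
    norm_num
  have hv3 : 13 / 16 ≤ v - 3 / 16 * b := by
    -- From `b ≤ v ^ 3`, it suffices that `v - (3/16) v ^ 3 ≥ 13/16` on `[1, 4/3]`, with equality at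
    -- 1.
    nlinarith [mul_nonneg (sub_nonneg.2 hv1) (sub_nonneg.2 hv2),
      mul_nonneg (mul_nonneg (sub_nonneg.2 hv1) (sub_nonneg.2 hv2)) hv0]
  -- The multiple `(3/16) b` of `h2` produces the term `3 b s`; the multiple `v - (3/16) b` of `h1`
  -- supplies the missing `(13/16) b r`.
  have hfin : b * (r + 3 * s) ≤ v * μ := by
    have e1 := mul_le_mul_of_nonneg_left h2 (show 0 ≤ 3 / 16 * b by linarith)
    have e2 := mul_le_mul_of_nonneg_left h1 (show 0 ≤ v - 3 / 16 * b by linarith)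
    have e3 := mul_le_mul_of_nonneg_right hv3 (mul_nonneg hb0 hr)
    linarith
  have := pow_le_pow_left₀ (by positivity) hfin k
  rw [mul_pow, mul_pow, hb, hvk] at this
  linarith

/-- The weight `exp((2/k) min((a - M)₊, L))`, which is bounded and has slowly varying logarithm. -/
noncomputable def expWeight (k : ℕ) (M L a : ℝ) : ℝ := Real.exp (2 / k * min (max (a - M) 0) L)

theorem expWeight_sub_sq_le (hk : 0 < k) (M L a b : ℝ) (h : |a - b| ≤ k) :
    (expWeight k M L a - expWeight k M L b) ^ 2 ≤ 8 * (expWeight k M L a * expWeight k M L b) := by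
  have hk' : (0 : ℝ) < k := by exact_mod_cast hk
  set u := 2 / k * min (max (a - M) 0) L with hu
  set v := 2 / k * min (max (b - M) 0) L with hv
  have h1 : |min (max (a - M) 0) L - min (max (b - M) 0) L| ≤ |a - b| := by
    refine (abs_inf_sub_inf_le_abs _ _ _).trans ((abs_sup_sub_sup_le_abs _ _ _).trans ?_)
    rw [sub_sub_sub_cancel_right]
  have h2 : |u - v| ≤ 2 := by
    rw [hu, hv, ← mul_sub, abs_mul, abs_of_pos (by positivity)]
    calc _ ≤ 2 / (k : ℝ) * k := by gcongr; exact h1.trans h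
      _ = 2 := by field_simp
  -- Since `|u - v| ≤ 2`, one has `e^{u-v} + e^{v-u} - 2 ≤ 1 + 9 - 2 = 8`, the constant of the
  -- statement.
  have he2 : Real.exp 2 ≤ 9 := by
    have := Real.exp_one_lt_d9
    rw [show (2 : ℝ) = 1 + 1 by norm_num, Real.exp_add]
    nlinarith [Real.exp_pos 1]
  have h3 : Real.exp (u - v) + Real.exp (v - u) ≤ 10 := by
    rw [abs_le] at h2
    rcases le_total u v with huv | huv
    · have e1 : Real.exp (u - v) ≤ 1 := Real.exp_le_one_iff.2 (by linarith)
      have e2 : Real.exp (v - u) ≤ Real.exp 2 := Real.exp_le_exp.2 (by linarith)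
      linarith
    · have e1 : Real.exp (v - u) ≤ 1 := Real.exp_le_one_iff.2 (by linarith)
      have e2 : Real.exp (u - v) ≤ Real.exp 2 := Real.exp_le_exp.2 (by linarith)
      linarith
  have e1 : Real.exp u * Real.exp v * Real.exp (u - v) = Real.exp u ^ 2 := by
    rw [← Real.exp_add, ← Real.exp_add, ← Real.exp_nat_mul]
    congr 1; push_cast; ring
  have e2 : Real.exp u * Real.exp v * Real.exp (v - u) = Real.exp v ^ 2 := by
    rw [← Real.exp_add, ← Real.exp_add, ← Real.exp_nat_mul]
    congr 1; push_cast; ring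
  have h4 := mul_le_mul_of_nonneg_left h3 (mul_pos (Real.exp_pos u) (Real.exp_pos v)).le
  change (Real.exp u - Real.exp v) ^ 2 ≤ 8 * (Real.exp u * Real.exp v)
  nlinarith

end

/-! ### Exponential concentration. -/

section

variable {Λ : Type*} {k : ℕ}

/-- The squared norm of the part of `φ` with more than `M` bosons on the site `i`. -/
noncomputable def tailSq (i : Λ) (M : ℝ) (φ : Config Λ → ℂ) : ℝ :=
  ∑' n, Set.indicator {n : Config Λ | M < (n i : ℝ)} (fun n => ‖φ n‖ ^ 2) n

/-- Markov's inequality. The maximum with 1 is free, because an integer `n i > M ≥ 0` is at least 1.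
-/
theorem max_sqrt_pow_mul_tailSq_le {M : ℝ} (hM : 0 ≤ M) {φ : Config Λ → ℂ}
    (hφ : FiniteMoments k φ) (i : Λ) :
    max (√M) 1 ^ k * tailSq i M φ ≤ rawMoment k i φ := by
  rw [tailSq, rawMoment, ← tsum_mul_left]
  refine ((hφ.sq.indicator _).mul_left _).tsum_le_tsum (fun n => ?_) (hφ.pow i)
  by_cases hn : M < (n i : ℝ)
  · rw [Set.indicator_of_mem (show n ∈ {n : Config Λ | M < (n i : ℝ)} from hn),
      rpow_half_eq_sqrt_pow k (Nat.cast_nonneg _)]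
    have h1 : (1 : ℝ) ≤ n i := by
      have : (0 : ℝ) < n i := hM.trans_lt hn
      exact_mod_cast (by exact_mod_cast this : 0 < n i)
    gcongr
    exact max_le (Real.sqrt_le_sqrt hn.le) (Real.one_le_sqrt.2 h1)
  · rw [Set.indicator_of_notMem (show n ∉ {n : Config Λ | M < (n i : ℝ)} from hn), mul_zero]
    positivity

variable [Fintype Λ] [DecidableEq Λ] {c : Coeffs Λ} {σ : Sector}

/-- The excess energy of the weighted ground state controls its largest moment. -/
theorem IsGroundState.weighted_repulsion {Ω : FockSpace Λ} (hΩ : IsGroundState k c σ Ω)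
    (hk : 2 ≤ k) {i : Λ} (hi : Jbar c i k = 0) {Jcheck u : ℝ}
    (hJ : ∀ Q : ℝ, 0 < Q → groundEnergy k c σ
        + ((u * Q ^ ((k : ℝ) / 2) - Jcheck * Q ^ (((k : ℝ) - 1) / 2) : ℝ) : EReal)
        ≤ energyAtMoment k c σ Q)
    {F : ℝ → ℝ} {C : ℝ} (hC : ∀ a, |F a| ≤ C) (hF0 : ∀ a, 0 ≤ F a)
    (hF : ∀ a b, |a - b| ≤ (k : ℝ) → (F a - F b) ^ 2 ≤ 8 * (F a * F b))
    (hN : 0 < normSq (diag (fun n => F (n i)) Ω)) {g : ℝ} (hg : 0 < g)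
    (hle : ∀ j, rawMoment k j (diag (fun n => F (n i)) Ω)
      ≤ g ^ k * normSq (diag (fun n => F (n i)) Ω))
    (heq : ∃ j, rawMoment k j (diag (fun n => F (n i)) Ω)
      = g ^ k * normSq (diag (fun n => F (n i)) Ω)) :
    u * g ^ k ≤ Jcheck * g ^ (k - 1) + 2 * calJbar k c * max g 1 ^ (k - 1) := by
  have hφ : FiniteMoments k (diag (fun n => F (n i)) Ω) :=
    hΩ.1.finiteMoments.diag_mul fun n => hC _
  have h1 := hΩ.repulsion_le (by omega) hJ hφ
    (fun n hn => by simp [diag, hΩ.1.2.1 n hn]) hN hg hle heq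
  have h2 := hΩ.localization hk (f := fun n => F (n i)) fun n => hC _
  -- The commutator bound needs `G ≥ 1`, hence `G = max g 1`. Its constant 4 becomes 2 through the
  -- factor `1/2` of the localization formula.
  have hG : ∀ j, rawMoment k j (diag (fun n => F (n i)) Ω)
      ≤ max g 1 ^ k * normSq (diag (fun n => F (n i)) Ω) := fun j =>
    (hle j).trans (mul_le_mul_of_nonneg_right
      (pow_le_pow_left₀ hg.le (le_max_left _ _) k) hN.le)
  have h3 := norm_commutator_le (c := c) hk hi hF0 hF hφ (le_max_right g 1) hG
  have h4 := (abs_le.1 ((Complex.abs_re_le_norm _).trans h3)).1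
  refine le_of_mul_le_mul_right ?_ hN
  linarith

/-- Exponential concentration of the boson number on a site without couplings of maximal degree. -/
theorem IsGroundState.tail_le {Ω : FockSpace Λ} (hΩ : IsGroundState k c σ Ω) (hk : 3 ≤ k) {i : Λ}
    (hUi : 0 < c.U i) (hi : Jbar c i k = 0) {Jcheck : ℝ}
    (hJ : ∀ Q : ℝ, 0 < Q → groundEnergy k c σ
        + ((c.U i * Q ^ ((k : ℝ) / 2) - Jcheck * Q ^ (((k : ℝ) - 1) / 2) : ℝ) : EReal)
        ≤ energyAtMoment k c σ Q) (x : ℝ) :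
    (expect (tailProj i x) Ω).re
      ≤ Real.exp (-(2 * (x - cutoff k c Jcheck i) / (k : ℝ))) := by
  have hk0 : (0 : ℝ) < k := by exact_mod_cast (by omega : 0 < k)
  have : Nonempty Λ := ⟨i⟩
  set M := cutoff k c Jcheck i with hM
  have hM0 : 0 ≤ M := le_max_of_le_right (sq_nonneg _)
  have hm : FiniteMoments k Ω := hΩ.1.finiteMoments
  have hN1 : normSq Ω = 1 := hΩ.1.normSq_eq_one
  have hT : (expect (tailProj i x) Ω).re
      = ∑' n, Set.indicator {n : Config Λ | x ≤ (n i : ℝ)} (fun n => ‖Ω n‖ ^ 2) n := by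
    rw [tailProj, expect_diag, Complex.ofReal_re]
    refine tsum_congr fun n => ?_
    by_cases hn : n ∈ {n : Config Λ | x ≤ (n i : ℝ)}
    · simp [Set.indicator_of_mem hn]
    · simp [Set.indicator_of_notMem hn]
  rw [hT]
  set T := ∑' n, Set.indicator {n : Config Λ | x ≤ (n i : ℝ)} (fun n => ‖Ω n‖ ^ 2) n with hTdef
  have hTs : Summable fun n =>
      Set.indicator {n : Config Λ | x ≤ (n i : ℝ)} (fun n => ‖Ω n‖ ^ 2) n := hm.sq.indicator _
  rcases le_or_gt x M with hx | hx
  · have h1 : T ≤ 1 := by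
      rw [← hN1]
      exact hTs.tsum_le_tsum (fun n => Set.indicator_le_self' (fun _ _ => sq_nonneg _) n) hm.sq
    refine h1.trans (Real.one_le_exp ?_)
    rw [neg_nonneg]
    exact div_nonpos_of_nonpos_of_nonneg (by linarith) hk0.le
  have hTtail : T ≤ tailSq i M Ω := by
    refine hTs.tsum_le_tsum (fun n => ?_) (hm.sq.indicator _)
    refine Set.indicator_le_indicator_of_subset (fun n hn => ?_) (fun _ => sq_nonneg _) n
    exact hx.trans_le hn
  set μ := √M with hμ
  have hμk : 0 < max μ 1 ^ k := pow_pos (lt_max_of_lt_right one_pos) k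
  set b : ℝ := (2 : ℝ) ^ ((k : ℝ)⁻¹) with hb
  have hb0 : 0 ≤ b := Real.rpow_nonneg (by norm_num) _
  have hbk : b ^ k = 2 := Real.rpow_inv_natCast_pow (by norm_num) (by omega)
  have hbr : b * (Jcheck / c.U i) ≤ μ := by
    refine Real.le_sqrt_of_sq_le ((le_of_eq ?_).trans (le_max_left _ _))
    rw [mul_pow, hb, ← Real.rpow_mul_natCast (by norm_num)]
    congr 2
    push_cast
    ring
  have hrs : Jcheck / c.U i + 16 * (calJbar k c / c.U i) ≤ μ := by
    refine Real.le_sqrt_of_sq_le ((le_of_eq ?_).trans (le_max_right _ _))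
    congr 1
    ring
  -- the unweighted ground state
  obtain ⟨g₀, hg₀, hle₀, heq₀⟩ := exists_max_rawMoment (k := k) (φ := Ω) (by omega)
    (by rw [hN1]; exact one_pos)
  have hT0 := (max_sqrt_pow_mul_tailSq_le hM0 hm i).trans (hle₀ i)
  rw [hN1, mul_one] at hT0
  rcases hg₀.eq_or_lt with h0 | hpos
  · rw [← h0, zero_pow (by omega)] at hT0
    exact (hTtail.trans (nonpos_of_mul_nonpos_right hT0 hμk)).trans (Real.exp_pos _).le
  -- The excess energy of `Ω` itself is zero, so the repulsion bound reads `U_i g₀ ^ k ≤ Jcheck * g₀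
  -- ^ (k - 1)`. It also shows that `Jcheck` is nonnegative here.
  have hg₀r : g₀ ≤ Jcheck / c.U i := by
    have h1 := hΩ.repulsion_le (by omega) hJ hm hΩ.1.2.1 (by rw [hN1]; exact one_pos) hpos
      hle₀ heq₀
    rw [hN1, mul_one] at h1
    have h2 : (expect (hamiltonian k c) Ω).re = energy k c Ω := rfl
    have hgk : g₀ ^ k = g₀ * g₀ ^ (k - 1) := by
      rw [← pow_succ', Nat.sub_add_cancel (by omega)]
    rw [le_div_iff₀ hUi]
    refine le_of_mul_le_mul_right ?_ (pow_pos hpos (k - 1))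
    rw [h2, hgk] at h1
    linarith
  have hr : 0 ≤ Jcheck / c.U i := hpos.le.trans hg₀r
  have hs : 0 ≤ calJbar k c / c.U i := div_nonneg (calJbar_nonneg k c i) hUi.le
  -- The factor `2^{2/k}` in `cutoff` serves this step: `b * g₀ ≤ μ` means that `g₀ ^ k` is at most
  -- half of `μ ^ k`.
  have hhalf : T ≤ 1 / 2 := by
    have h1 : (b * g₀) ^ k ≤ max μ 1 ^ k :=
      pow_le_pow_left₀ (by positivity)
        (((mul_le_mul_of_nonneg_left hg₀r hb0).trans hbr).trans (le_max_left _ _)) k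
    rw [mul_pow, hbk] at h1
    have h2 : tailSq i M Ω ≤ 1 / 2 := by
      refine le_of_mul_le_mul_left ?_ hμk
      linarith
    exact hTtail.trans h2
  -- the exponentially weighted ground state
  set F := expWeight k M (x - M) with hF
  have hL : 0 ≤ x - M := by linarith
  have hF1 : ∀ a, 1 ≤ F a := fun a =>
    Real.one_le_exp (mul_nonneg (by positivity) (le_min (le_max_right _ _) hL))
  have hF0 : ∀ a, 0 ≤ F a := fun a => zero_le_one.trans (hF1 a)
  have hFC : ∀ a, |F a| ≤ Real.exp (2 / k * (x - M)) := fun a => by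
    rw [abs_of_nonneg (hF0 a)]
    exact Real.exp_le_exp.2 (mul_le_mul_of_nonneg_left (min_le_right _ _) (by positivity))
  set φ := diag (fun n => F (n i)) Ω with hφdef
  have hφ : FiniteMoments k φ := hm.diag_mul fun n => hFC _
  have hφn : ∀ n, ‖φ n‖ ^ 2 = F (n i) ^ 2 * ‖Ω n‖ ^ 2 := fun n => by
    rw [hφdef, norm_diag_apply, mul_pow, sq_abs]
  have hφN : 0 < normSq φ := by
    have : normSq Ω ≤ normSq φ := hm.sq.tsum_le_tsum (fun n => by
      rw [hφn]
      exact le_mul_of_one_le_left (sq_nonneg _) (one_le_pow₀ (hF1 _))) hφ.sq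
    linarith
  have hsplit : normSq φ ≤ tailSq i M φ + 1 := by
    rw [← hN1, normSq, normSq, tailSq, ← (hφ.sq.indicator _).tsum_add hm.sq]
    refine hφ.sq.tsum_le_tsum (fun n => ?_) ((hφ.sq.indicator _).add hm.sq)
    by_cases hn : M < (n i : ℝ)
    · rw [Set.indicator_of_mem (show n ∈ {n : Config Λ | M < (n i : ℝ)} from hn)]
      exact le_add_of_nonneg_right (sq_nonneg _)
    · rw [Set.indicator_of_notMem (show n ∉ {n : Config Λ | M < (n i : ℝ)} from hn), hφn]
      have : F (n i) = 1 := by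
        rw [hF, expWeight, max_eq_right (by linarith), min_eq_left hL, mul_zero, Real.exp_zero]
      rw [this]
      simp
  obtain ⟨g, hg, hle, heq⟩ := exists_max_rawMoment (k := k) (φ := φ) (by omega) hφN
  have hgμ : g ^ k ≤ 2 / 3 * max μ 1 ^ k := by
    rcases hg.eq_or_lt with h0 | hpos'
    · rw [← h0, zero_pow (by omega)]
      positivity
    · have h1 := hΩ.weighted_repulsion (by omega) hi hJ hFC hF0
        (expWeight_sub_sq_le (by omega) M (x - M)) hφN hpos' hle heq
      refine pow_le_of_repulsion hk hr hs hb0 hbk hbr hrs hpos' ?_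
      refine le_of_mul_le_mul_left (h1.trans (le_of_eq ?_)) hUi
      field_simp
  -- The weight is 1 up to `M`, so `‖φ‖² ≤ tail + 1`; Markov then gives `tail ≤ (2/3)(tail + 1)`.
  have htail : tailSq i M φ ≤ 2 := by
    have h1 := (max_sqrt_pow_mul_tailSq_le hM0 hφ i).trans (hle i)
    have h2 := h1.trans ((mul_le_mul_of_nonneg_right hgμ hφN.le).trans
      (mul_le_mul_of_nonneg_left hsplit (by positivity)))
    refine le_of_mul_le_mul_left ?_ hμk
    linarith
  set y := 2 * (x - M) / (k : ℝ) with hy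
  have hexp : Real.exp y ^ 2 * T ≤ 2 := by
    refine le_trans ?_ htail
    rw [hTdef, ← tsum_mul_left]
    refine (hTs.mul_left _).tsum_le_tsum (fun n => ?_) (hφ.sq.indicator _)
    by_cases hn : x ≤ (n i : ℝ)
    · rw [Set.indicator_of_mem (show n ∈ {n : Config Λ | x ≤ (n i : ℝ)} from hn),
        Set.indicator_of_mem (show n ∈ {n : Config Λ | M < (n i : ℝ)} from hx.trans_le hn), hφn,
        hF, expWeight, max_eq_left (by linarith), min_eq_right (by linarith), hy]
      refine le_of_eq ?_
      congr 3
      ring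
    · rw [Set.indicator_of_notMem (show n ∉ {n : Config Λ | x ≤ (n i : ℝ)} from hn), mul_zero]
      exact Set.indicator_nonneg (fun _ _ => sq_nonneg _) n
  rw [Real.exp_neg]
  have hepos := Real.exp_pos y
  rw [← one_div, le_div_iff₀ hepos]
  -- If `e^y ≤ 2`, use `T ≤ 1/2`; otherwise use `T ≤ 2e^{-2y}`. The two bounds cross at `e^y = 2`.
  rcases le_total (Real.exp y) 2 with h2 | h2
  · nlinarith
  · nlinarith

end

end BoseHubbard

theorem mainTheorem2 {Λ : Type*} [Fintype Λ] [DecidableEq Λ] (k : ℕ) (hk : 3 ≤ k)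
    (c : BoseHubbard.Coeffs Λ)
    (hH : BoseHubbard.IsHermitian (BoseHubbard.hamiltonian k c))
    (hV : ∀ m idx, 0 ≤ c.V m idx)
    (hU : ∀ j, 5 * BoseHubbard.Jbar c j k < c.U j)
    (σ : BoseHubbard.Sector)
    (hσ : ∀ N, σ = BoseHubbard.Sector.fixed N →
      BoseHubbard.ConservesNumber (BoseHubbard.hamiltonian k c))
    (Ω : BoseHubbard.FockSpace Λ) (hΩ : BoseHubbard.IsGroundState k c σ Ω)
    (Jcheck : ℝ)
    (hJcheck : ∀ Q : ℝ, 0 < Q → ∀ j : Λ,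
      BoseHubbard.groundEnergy k c σ
        + (((c.U j - BoseHubbard.Jbar c j k) * Q ^ ((k : ℝ) / 2)
            - Jcheck * Q ^ (((k : ℝ) - 1) / 2) : ℝ) : EReal)
        ≤ BoseHubbard.energyAtMoment k c σ Q)
    (i : Λ) (hi : BoseHubbard.Jbar c i k = 0) (x : ℝ) :
    (BoseHubbard.expect (BoseHubbard.tailProj i x) Ω).re
      ≤ Real.exp (-(2 * (x - BoseHubbard.cutoff k c Jcheck i) / (k : ℝ))) := by
  have hUi := hU i
  rw [hi, mul_zero] at hUi
  refine hΩ.tail_le hk hUi hi (fun Q hQ => ?_) x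
  have h := hJcheck Q hQ i
  rwa [hi, sub_zero] at h
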